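/- Let $X$ be a Polish space, i.e. a separable space with a fixed complete metric, let $\mathcal M(X)$ be the space of Borel measures on $X$ that are finite on bounded sets, and $\mathcal M^{\cdot\cdot}(X)\subset\mathcal M(X)$ the set of point measures (measures with integer values on bounded Borel sets), with the $\sigma$-algebras generated by the evaluations $\mu\mapsto\mu(B)$, $B$ a bounded Borel set. For $\kappa\in\mathcal M(X)$ let $\mathrm{Poi}_\kappa$ be the law on $\mathcal M^{\cdot\cdot}(X)$ of the Poisson process with intensity measure $\kappa$. For $z\in(0,1)$ and $\rho\in\mathcal M(X)$ let the Poisson–Gamma random measure $\mathrm{GP}_{z,\rho}$ be the law on $\mathcal M(X)$ of the infinitely divisible random measure (without deterministic part) whose Lévy measure is the image of $\rho\otimes\tau_z$, $\tau_z(dr)=r^{-1}e^{-\frac{1-z}{z}r}\,dr$ on $(0,\infty)$, under $(x,r)\mapsto r\delta_x$. Let $z\in(0,1)$ and $\rho\in\mathcal M(X)$. Then $\kappa\mapsto\mathrm{Poi}_\kappa$ is a measurable family of probability measures, $\mathrm{GP}_{z,\rho}$ is a probability measure, and the mixture $$\mathrm{Poy}_{z,\rho}=\int \mathrm{Poi}_\kappa\,\mathrm{GP}_{z,\rho}(d\kappa)$$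 is the Pólya sum process, i.e. the unique probability measure $P$ on $\mathcal M^{\cdot\cdot}(X)$ such that $$\iint h(x,\mu)\,\mu(dx)\,P(d\mu)=z\iint h(x,\mu+\delta_x)\,(\rho+\mu)(dx)\,P(d\mu)$$ for all measurable $h\ge 0$. Moreover the posterior (Bayes kernel), that is, the Markov kernel $B$ from $\mathcal M^{\cdot\cdot}(X)$ to $\mathcal M(X)$ with $$\iint f(\mu,\kappa)\,\mathrm{Poi}_\kappa(d\mu)\,\mathrm{GP}_{z,\rho}(d\kappa)=\iint f(\mu,\kappa)\,B(\mu,d\kappa)\,\mathrm{Poy}_{z,\rho}(d\mu)$$ for all measurable $f\ge 0$, is again a Poisson–Gamma random measure: $$B(\mu,\cdot)=\mathrm{GP}_{\frac{z}{1+z},\,\rho+\mu}.$$ That is, $\mu\mapsto\mathrm{GP}_{\frac{z}{1+z},\rho+\mu}$ is such a Markov kernel, and every such $B$ agrees with it for $\mathrm{Poy}_{z,\rho}$-almost every $\mu$. -/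

import Mathlib

open MeasureTheory ProbabilityTheory
open scoped ENNReal

noncomputable section

namespace CoxBayes

section Poisson

variable {E : Type*} [MeasurableSpace E]

/-- The random number of independent points construction: the law of `δ_{x_1} + ... + δ_{x_N}`,
where `N` has the Poisson distribution with mean `lam(E)` and, given `N = n`, the points
`x_1, ..., x_n` are independent with law `lam / lam(E)`. This is
`∑ n, exp (-lam(E)) / n! • (image of lam^{⊗ n} under (x_1, ..., x_n) ↦ δ_{x_1} + ... + δ_{x_n})`. -/
def finitePoisson (lam : Measure E) : Measure (Measure E) :=
  Measure.sum fun n : ℕ =>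
    ENNReal.ofReal (Real.exp (-(lam Set.univ).toReal) / (n.factorial : ℝ)) •
      (Measure.pi fun _ : Fin n => lam).map (fun x => ∑ i, Measure.dirac (x i))

lemma measurable_sum_dirac (n : ℕ) :
    Measurable (fun x : Fin n → E => ∑ i, Measure.dirac (x i)) := by
  refine Measure.measurable_of_measurable_coe _ fun s hs => ?_
  simp only [Measure.coe_finsetSum, Finset.sum_apply]
  exact Finset.measurable_sum _ fun i _ =>
    (Measure.measurable_coe hs).comp (Measure.measurable_dirac.comp (measurable_pi_apply i))

instance (lam : Measure E) [IsFiniteMeasure lam] : IsProbabilityMeasure (finitePoisson lam) := by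
  constructor
  have key : ∀ n : ℕ,
      (ENNReal.ofReal (Real.exp (-(lam Set.univ).toReal) / (n.factorial : ℝ)) •
        (Measure.pi fun _ : Fin n => lam).map (fun x => ∑ i, Measure.dirac (x i))) Set.univ
      = ENNReal.ofReal (Real.exp (-(lam Set.univ).toReal) *
          ((lam Set.univ).toReal ^ n / (n.factorial : ℝ))) := by
    intro n
    rw [Measure.smul_apply, Measure.map_apply (measurable_sum_dirac n) MeasurableSet.univ,
      Set.preimage_univ, Measure.pi_univ, Finset.prod_const, Finset.card_univ, Fintype.card_fin,
      smul_eq_mul, ← ENNReal.ofReal_toReal (measure_ne_top lam Set.univ),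
      ← ENNReal.ofReal_pow ENNReal.toReal_nonneg, ← ENNReal.ofReal_mul (by positivity)]
    congr 1
    rw [ENNReal.toReal_ofReal ENNReal.toReal_nonneg]
    ring
  have hs : HasSum (fun n : ℕ => Real.exp (-(lam Set.univ).toReal) *
      ((lam Set.univ).toReal ^ n / (n.factorial : ℝ))) 1 := by
    have h := (NormedSpace.expSeries_div_hasSum_exp (𝔸 := ℝ) (lam Set.univ).toReal).mul_left
      (Real.exp (-(lam Set.univ).toReal))
    rwa [← Real.exp_eq_exp_ℝ, ← Real.exp_add, neg_add_cancel, Real.exp_zero] at h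
  rw [finitePoisson, Measure.sum_apply _ MeasurableSet.univ, tsum_congr key,
    ← ENNReal.ofReal_tsum_of_nonneg (fun n => by positivity) hs.summable, hs.tsum_eq,
    ENNReal.ofReal_one]

/-- The law of the Poisson process (Poisson random measure) with s-finite intensity measure `lam`:
the superposition of independent Poisson processes whose intensities are finite measures adding
up to `lam`. -/
def poissonRandomMeasure (lam : Measure E) [SFinite lam] : Measure (Measure E) :=
  (Measure.infinitePi fun n : ℕ => finitePoisson (sfiniteSeq lam n)).map
    (fun N : ℕ → Measure E => Measure.sum N)

lemma measurable_measure_sum : Measurable (fun N : ℕ → Measure E => Measure.sum N) := by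
  refine Measure.measurable_of_measurable_coe _ fun s hs => ?_
  simp only [Measure.sum_apply _ hs]
  exact Measurable.tsum fun n => (Measure.measurable_coe hs).comp (measurable_pi_apply n)

instance (lam : Measure E) [SFinite lam] : IsProbabilityMeasure (poissonRandomMeasure lam) :=
  Measure.isProbabilityMeasure_map measurable_measure_sum.aemeasurable

end Poisson

section Spaces

variable (X : Type*) [MetricSpace X] [MeasurableSpace X]

/-- The space of locally finite measures: finite mass on every bounded set. Its σ-algebra is the
one induced by all evaluations `μ ↦ μ B`, `B` measurable; see `locFin_measurableSpace_eq`. -/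
abbrev LocFin : Type _ := {μ : Measure X // ∀ B : Set X, Bornology.IsBounded B → μ B < ∞}

/-- The space of locally finite point measures (point configurations with multiplicities): the
locally finite measures taking integer values on bounded measurable sets. -/
abbrev PointMeas : Type _ :=
  {μ : LocFin X // ∀ B : Set X, Bornology.IsBounded B → MeasurableSet B →
    ∃ n : ℕ, (μ : Measure X) B = n}

variable {X}

instance : Add (LocFin X) where
  add μ ν := ⟨μ.1 + ν.1, fun B hB => ENNReal.add_lt_top.2 ⟨μ.2 B hB, ν.2 B hB⟩⟩

/-- The point configuration `μ + δ_x`. -/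
def PointMeas.addPoint [BorelSpace X] (μ : PointMeas X) (x : X) : PointMeas X :=
  ⟨⟨μ.1.1 + Measure.dirac x, fun B hB =>
      ENNReal.add_lt_top.2 ⟨μ.1.2 B hB, measure_lt_top _ _⟩⟩, fun B hB hm => by
    obtain ⟨n, hn⟩ := μ.2 B hB hm
    by_cases hx : x ∈ B
    · exact ⟨n + 1, by simp [hn, hm, hx]⟩
    · exact ⟨n, by simp [hn, hm, hx]⟩⟩

instance (μ : LocFin X) : SFinite (μ : Measure X) := by
  rcases isEmpty_or_nonempty X with h | ⟨⟨x⟩⟩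
  · have : (μ : Measure X) = 0 := Measure.eq_zero_of_isEmpty _
    rw [this]; infer_instance
  · have : SigmaFinite (μ : Measure X) :=
      ⟨⟨{ set := fun n : ℕ => Metric.ball x n
          set_mem := fun _ => trivial
          finite := fun n => μ.2 _ Metric.isBounded_ball
          spanning := Metric.iUnion_ball_nat x }⟩⟩
    infer_instance

/-- The σ-algebra of the space of locally finite measures is generated by the evaluations
`μ ↦ μ B` at bounded measurable sets. -/
lemma locFin_measurableSpace_eq [BorelSpace X] :
    (Subtype.instMeasurableSpace : MeasurableSpace (LocFin X)) =
      ⨆ (B : Set X) (_ : Bornology.IsBounded B ∧ MeasurableSet B),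
        (borel ℝ≥0∞).comap (fun μ : LocFin X => (μ : Measure X) B) := by
  apply le_antisymm
  · rcases isEmpty_or_nonempty X with h | ⟨⟨x⟩⟩
    · have : Subsingleton (LocFin X) :=
        ⟨fun a b => Subtype.ext (Subsingleton.elim _ _)⟩
      have key : ∀ m m' : MeasurableSpace (LocFin X), m ≤ m' := fun m m' s _ => by
        rcases Set.eq_empty_or_nonempty s with rfl | ⟨a, ha⟩
        · exact @MeasurableSet.empty _ m'
        · have : s = Set.univ := Set.eq_univ_of_forall fun b => Subsingleton.elim a b ▸ ha
          rw [this]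
          exact @MeasurableSet.univ _ m'
      exact key _ _
    · refine Measurable.comap_le ?_
      refine @Measure.measurable_of_measurable_coe _ _ _ (_) _ fun s hs => ?_
      have hlim : ∀ μ : LocFin X,
          (μ : Measure X) s = ⨆ n : ℕ, (μ : Measure X) (s ∩ Metric.ball x n) := by
        intro μ
        rw [← Monotone.measure_iUnion, ← Set.inter_iUnion, Metric.iUnion_ball_nat,
          Set.inter_univ]
        exact fun m n hmn => Set.inter_subset_inter_right _
          (Metric.ball_subset_ball (Nat.cast_le.2 hmn))
      simp only [hlim]
      refine Measurable.iSup fun n => ?_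
      have hB : Bornology.IsBounded (s ∩ Metric.ball x n) ∧
          MeasurableSet (s ∩ Metric.ball x n) :=
        ⟨Metric.isBounded_ball.subset Set.inter_subset_right,
          hs.inter Metric.isOpen_ball.measurableSet⟩
      rw [measurable_iff_comap_le]
      exact le_iSup₂_of_le (s ∩ Metric.ball x n) hB le_rfl
  · refine iSup₂_le fun B hB => ?_
    exact ((Measure.measurable_coe hB.2).comp measurable_subtype_coe).comap_le

/-- The set of locally finite measures is measurable. -/
lemma measurableSet_locFin [BorelSpace X] :
    MeasurableSet {μ : Measure X | ∀ B : Set X, Bornology.IsBounded B → μ B < ∞} := by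
  rcases isEmpty_or_nonempty X with h | ⟨⟨x⟩⟩
  · exact Set.Subsingleton.measurableSet fun _ _ _ _ => Subsingleton.elim _ _
  · have : {μ : Measure X | ∀ B : Set X, Bornology.IsBounded B → μ B < ∞} =
        ⋂ n : ℕ, {μ : Measure X | μ (Metric.ball x n) < ∞} := by
      ext μ
      simp only [Set.mem_ofPred_eq, Set.mem_iInter]
      refine ⟨fun h n => h _ Metric.isBounded_ball, fun h B hB => ?_⟩
      obtain ⟨r, hr⟩ := hB.subset_ball x
      obtain ⟨n, hn⟩ := exists_nat_ge r
      exact (measure_mono (hr.trans (Metric.ball_subset_ball hn))).trans_lt (h n)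
    rw [this]
    exact MeasurableSet.iInter fun n =>
      measurableSet_lt (Measure.measurable_coe Metric.isOpen_ball.measurableSet) measurable_const

/-- The set of locally finite point measures is measurable. -/
lemma measurableSet_pointMeas [BorelSpace X] [SecondCountableTopology X] :
    MeasurableSet {μ : LocFin X | ∀ B : Set X, Bornology.IsBounded B → MeasurableSet B →
      ∃ n : ℕ, (μ : Measure X) B = n} := by
  rcases isEmpty_or_nonempty X with h | ⟨⟨x⟩⟩
  · exact Set.Subsingleton.measurableSet fun _ _ _ _ => Subtype.ext (Subsingleton.elim _ _)
  obtain ⟨b, hbc, -, hb⟩ := TopologicalSpace.exists_countable_basis X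
  have hgen : ‹MeasurableSpace X› =
      MeasurableSpace.generateFrom (generatePiSystem b) := by
    rw [generateFrom_generatePiSystem_eq, ← hb.borel_eq_generateFrom]
    exact BorelSpace.measurable_eq
  have hpc : (generatePiSystem b).Countable := by
    refine (Set.countable_ofPred_finite_subset hbc).image (fun t => ⋂₀ t) |>.mono ?_
    intro s hs
    induction hs with
    | base h => exact ⟨{_}, ⟨Set.finite_singleton _, by simpa using h⟩, by simp⟩
    | inter _ _ _ h1 h2 =>
      obtain ⟨t1, ⟨hf1, hs1⟩, rfl⟩ := h1
      obtain ⟨t2, ⟨hf2, hs2⟩, rfl⟩ := h2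
      exact ⟨t1 ∪ t2, ⟨hf1.union hf2, Set.union_subset hs1 hs2⟩, Set.sInter_union _ _⟩
  have hpm : ∀ s ∈ generatePiSystem b, MeasurableSet s := by
    intro s hs
    rw [hgen]
    exact MeasurableSpace.measurableSet_generateFrom hs
  have hnat : MeasurableSet (Set.range ((↑) : ℕ → ℝ≥0∞)) :=
    (Set.countable_range _).measurableSet
  have heq : {μ : LocFin X | ∀ B : Set X, Bornology.IsBounded B → MeasurableSet B →
      ∃ n : ℕ, (μ : Measure X) B = n} =
      ⋂ k : ℕ, ({μ : LocFin X | (μ : Measure X) (Metric.ball x k) ∈ Set.range ((↑) : ℕ → ℝ≥0∞)} ∩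
        ⋂ s ∈ generatePiSystem b,
          {μ : LocFin X | (μ : Measure X) (s ∩ Metric.ball x k) ∈
            Set.range ((↑) : ℕ → ℝ≥0∞)}) := by
    ext μ
    simp only [Set.mem_ofPred_eq, Set.mem_iInter, Set.mem_inter_iff, Set.mem_range]
    constructor
    · intro h k
      refine ⟨(h _ Metric.isBounded_ball Metric.isOpen_ball.measurableSet).imp fun _ => Eq.symm,
        fun s hs => (h _ (Metric.isBounded_ball.subset Set.inter_subset_right)
          ((hpm s hs).inter Metric.isOpen_ball.measurableSet)).imp fun _ => Eq.symm⟩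
    · intro h B hB hm
      obtain ⟨r, hr⟩ := hB.subset_ball x
      obtain ⟨k, hk⟩ := exists_nat_ge r
      have hBk : B ⊆ Metric.ball x k := hr.trans (Metric.ball_subset_ball hk)
      obtain ⟨⟨N, hN⟩, hk⟩ := h k
      suffices H : ∀ s, MeasurableSet s →
          ∃ n : ℕ, (μ : Measure X) (s ∩ Metric.ball x k) = n by
        simpa only [Set.inter_eq_left.2 hBk] using H B hm
      intro s hs
      induction s, hs using MeasurableSpace.induction_on_inter hgen
        (isPiSystem_generatePiSystem b) with
      | empty => exact ⟨0, by simp⟩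
      | basic t ht => exact (hk t ht).imp fun _ => Eq.symm
      | compl t htm ih =>
        obtain ⟨n, hn⟩ := ih
        refine ⟨N - n, ?_⟩
        have h1 := measure_inter_add_sdiff (μ := (μ : Measure X)) (Metric.ball x k) htm
        rw [Set.inter_comm, hn, ← hN] at h1
        rw [Set.inter_comm, ← Set.sdiff_eq, ENNReal.natCast_sub, ← h1,
          ENNReal.add_sub_cancel_left (ENNReal.natCast_ne_top n)]
      | iUnion f hd hfm ih =>
        choose n hn using ih
        have h1 : (μ : Measure X) ((⋃ i, f i) ∩ Metric.ball x k) = ∑' i, (n i : ℝ≥0∞) := by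
          rw [Set.iUnion_inter, measure_iUnion]
          · exact tsum_congr hn
          · exact fun i j hij => (hd hij).mono Set.inter_subset_left Set.inter_subset_left
          · exact fun i => (hfm i).inter Metric.isOpen_ball.measurableSet
        have h2 : ∑' i, (n i : ℝ≥0∞) ≠ ∞ := by
          rw [← h1]
          exact (μ.2 _ (Metric.isBounded_ball.subset Set.inter_subset_right)).ne
        have h3 : (Function.support n).Finite := by
          have := ENNReal.finite_const_le_of_tsum_ne_top h2 one_ne_zero
          refine this.subset fun i hi => ?_
          have : 1 ≤ n i := Nat.one_le_iff_ne_zero.2 hi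
          simpa using mod_cast this
        refine ⟨∑ i ∈ h3.toFinset, n i, ?_⟩
        rw [h1, tsum_eq_sum (s := h3.toFinset), Nat.cast_sum]
        intro i hi
        simpa using hi
  rw [heq]
  refine MeasurableSet.iInter fun k => MeasurableSet.inter ?_
    (MeasurableSet.biInter hpc fun s hs => ?_)
  · exact ((Measure.measurable_coe Metric.isOpen_ball.measurableSet).comp
      measurable_subtype_coe) hnat
  · exact ((Measure.measurable_coe ((hpm s hs).inter Metric.isOpen_ball.measurableSet)).comp
      measurable_subtype_coe) hnat

end Spaces

section Processes

variable {X : Type*} [MetricSpace X] [MeasurableSpace X]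

/-- The law of the Poisson process with locally finite intensity measure `κ`, as a probability
measure on the space of locally finite point measures. -/
def poissonProcess (κ : LocFin X) : Measure (PointMeas X) :=
  (poissonRandomMeasure (κ : Measure X)).comap (fun μ : PointMeas X => (μ.1 : Measure X))

/-- The infinitely divisible random measure with Lévy measure `Lam` (and no deterministic part):
the law of `∫ ν N(dν)`, where `N` is a Poisson process on the space of locally finite measures
with intensity `Lam`. -/
def infDivRandomMeasure (Lam : Measure (LocFin X)) [SFinite Lam] : Measure (LocFin X) :=
  ((poissonRandomMeasure Lam).map
    (fun N : Measure (LocFin X) => N.bind (fun ν => (ν : Measure X)))).comap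
      (fun κ : LocFin X => (κ : Measure X))

/-- The map `(x, r) ↦ r δ_x`. -/
def scaledDirac (p : X × ℝ) : LocFin X :=
  ⟨ENNReal.ofReal p.2 • Measure.dirac p.1, fun _ _ => by
    rw [Measure.smul_apply, smul_eq_mul]
    exact ENNReal.mul_lt_top ENNReal.ofReal_lt_top (measure_lt_top _ _)⟩

lemma measurable_scaledDirac : Measurable (scaledDirac : X × ℝ → LocFin X) := by
  refine Measurable.subtype_mk (Measure.measurable_of_measurable_coe _ fun s hs => ?_)
  simp only [Measure.smul_apply, smul_eq_mul]
  exact (ENNReal.measurable_ofReal.comp measurable_snd).mul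
    ((Measure.measurable_coe hs).comp (Measure.measurable_dirac.comp measurable_fst))

/-- The measure `τ_z(dr) = r⁻¹ exp (-((1 - z) / z) r) dr` on `(0, ∞)`. -/
def gammaLevy (z : ℝ) : Measure ℝ :=
  (volume.restrict (Set.Ioi 0)).withDensity
    (fun r => ENNReal.ofReal (r⁻¹ * Real.exp (-((1 - z) / z) * r)))

instance (z : ℝ) : SFinite (gammaLevy z) := by unfold gammaLevy; infer_instance

/-- The Lévy measure of the Poisson-Gamma random measure: the image of `ρ ⊗ τ_z` under
`(x, r) ↦ r δ_x`. -/
def poissonGammaLevy (z : ℝ) (ρ : LocFin X) : Measure (LocFin X) :=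
  ((ρ : Measure X).prod (gammaLevy z)).map scaledDirac

instance (z : ℝ) (ρ : LocFin X) : SFinite (poissonGammaLevy z ρ) := by
  unfold poissonGammaLevy; infer_instance

/-- The Poisson-Gamma random measure with parameters `z` and `ρ`. -/
def poissonGamma (z : ℝ) (ρ : LocFin X) : Measure (LocFin X) :=
  infDivRandomMeasure (poissonGammaLevy z ρ)

/-- The Cox process directed by the random measure `Q`: the mixture `∫ Poi_κ Q(dκ)`. -/
def coxProcess (Q : Measure (LocFin X)) : Measure (PointMeas X) :=
  Q.bind poissonProcess

/-- `P` is the law of a Pólya sum process with parameters `z` and `ρ`: a point process with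
Papangelou kernel `z (ρ + μ)`, that is, a solution of
`∬ h(x, μ) μ(dx) P(dμ) = z ∬ h(x, μ + δ_x) (ρ + μ)(dx) P(dμ)`. -/
structure IsPolyaSumProcess [BorelSpace X] (z : ℝ) (ρ : LocFin X)
    (P : Measure (PointMeas X)) : Prop where
  isProbabilityMeasure : IsProbabilityMeasure P
  campbell : ∀ h : X → PointMeas X → ℝ≥0∞, Measurable (Function.uncurry h) →
    ∫⁻ μ, ∫⁻ x, h x μ ∂(μ.1 : Measure X) ∂P =
      ENNReal.ofReal z *
        ∫⁻ μ, ∫⁻ x, h x (μ.addPoint x) ∂((ρ + μ.1 : LocFin X) : Measure X) ∂P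

/-- `B` is a Bayes kernel (posterior) for the family of Poisson processes with the prior `Q` on
the intensity measure and the resulting mixture `P`:
`∬ f(μ, κ) Poi_κ(dμ) Q(dκ) = ∬ f(μ, κ) B(μ, dκ) P(dμ)`. -/
structure IsBayesKernel (Q : Measure (LocFin X)) (P : Measure (PointMeas X))
    (B : Kernel (PointMeas X) (LocFin X)) : Prop where
  isMarkovKernel : IsMarkovKernel B
  disintegration : ∀ f : PointMeas X → LocFin X → ℝ≥0∞, Measurable (Function.uncurry f) →
    ∫⁻ κ, ∫⁻ μ, f μ κ ∂(poissonProcess κ) ∂Q = ∫⁻ μ, ∫⁻ κ, f μ κ ∂(B μ) ∂P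

end Processes

end CoxBayes

end

open CoxBayes

/-! The proof runs on Laplace functionals `∫ exp (-μ(f))`, with `f` bounded, measurable and of
bounded support. They determine the law of a random measure, and in joint form the law of a pair
(`ext_of_laplace_pair`). For the Poisson process the functional is `exp (-κ(1 - e^{-f}))`. The same
formula for a Poisson process on the space of measures, together with Frullani's integral, gives
`exp (-ρ(φ_z(f)))` for the Poisson-Gamma measure, where `φ_z(s) = log (1 + s z / (1 - z))`.

Posterior: put `w = z / (1 + z)`, so that `φ_w(s) = log (1 + s z)`. Drawing `κ` from the prior and
then `μ` from `Poi_κ`, the pair has transform `exp (-ρ(φ_z(g + 1 - e^{-f})))`. Drawing `μ` from the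
mixture and then `κ` from `GP_{w, ρ + μ}`, it has transform `exp (-ρ(φ_w(g) + φ_z(1 - e^{-f -
φ_w(g)})))`. The exponents agree pointwise (`gammaExponent_add_one_sub_negExp`). Almost sure
uniqueness of the kernel holds because the σ-algebra of `LocFin X` is countably generated.

Pólya equation: given `κ`, Mecke's formula turns `μ(dx)` into `κ(dx)` with the point `x` added to
`μ`. Exchanging the order of conditioning, `κ` is averaged under the posterior, whose mean is `w /
(1 - w) (ρ + μ) = z (ρ + μ)`.

Uniqueness: the equation, tested on `g(x) exp (-t μ(f))` for a suitable `g`, becomes a linear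
differential equation in `t` for `∫ exp (-t μ(f)) dP` whose coefficient depends only on `z`, `ρ` and
`f` (`IsPolyaSumProcess.lintegral_mul_negExp`). -/

noncomputable section

namespace CoxBayes

/-! ### The exponential `exp (-x)` on `[0, ∞]`, with value `0` at `∞`. -/

section NegExp

/-- The function `x ↦ exp (-x)` on `[0, ∞]`. -/
def negExp (x : ℝ≥0∞) : ℝ≥0∞ := EReal.exp (-(x : EReal))

@[simp] lemma negExp_zero : negExp 0 = 1 := by simp [negExp]

lemma negExp_eq_inv (x : ℝ≥0∞) : negExp x = (EReal.exp (x : EReal))⁻¹ := by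
  rw [negExp, EReal.exp_neg]

lemma negExp_add (x y : ℝ≥0∞) : negExp (x + y) = negExp x * negExp y := by
  simp only [negExp_eq_inv, EReal.coe_ennreal_add, EReal.exp_add]
  refine ENNReal.mul_inv (Or.inl ?_) (Or.inr ?_)
  · simp
  · simp

lemma negExp_ofReal {r : ℝ} (hr : 0 ≤ r) :
    negExp (ENNReal.ofReal r) = ENNReal.ofReal (Real.exp (-r)) := by
  rw [negExp, EReal.coe_ennreal_ofReal, max_eq_left hr, ← EReal.coe_neg, EReal.exp_coe]

lemma negExp_le_one (x : ℝ≥0∞) : negExp x ≤ 1 := by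
  simp [negExp, EReal.coe_ennreal_nonneg]

lemma continuous_negExp : Continuous negExp :=
  ENNReal.continuous_exp.comp (continuous_neg.comp continuous_coe_ennreal_ereal)

lemma measurable_negExp : Measurable negExp := continuous_negExp.measurable

lemma negExp_sum {ι : Type*} (s : Finset ι) (f : ι → ℝ≥0∞) :
    negExp (∑ i ∈ s, f i) = ∏ i ∈ s, negExp (f i) := by
  classical
  induction s using Finset.induction_on with
  | empty => simp
  | insert i s hi ih => rw [Finset.sum_insert hi, Finset.prod_insert hi, negExp_add, ih]

end NegExp

/-! ### A functional monotone class theorem for families of probability measures. -/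

section MonotoneClass

lemma measurable_of_forall_measurableSet_lt {Ω : Type*} {m : MeasurableSpace Ω} {f : Ω → ℝ}
    (h : ∀ a, MeasurableSet {ω | a < f ω}) : Measurable f := measurable_of_Ioi h

variable {T Ω : Type*} [MeasurableSpace T] [mΩ : MeasurableSpace Ω]

/-- `F` is bounded and measurable, and its integrals against the measures `K t` depend measurably
on `t`. -/
structure HasMeasurableIntegral (K : T → Measure Ω) (F : Ω → ℝ) : Prop where
  measurable : Measurable F
  bounded : ∃ C, ∀ ω, |F ω| ≤ C
  integral : Measurable fun t => ∫ ω, F ω ∂K t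

variable {K : T → Measure Ω} [∀ t, IsProbabilityMeasure (K t)]

lemma HasMeasurableIntegral.integrable {F : Ω → ℝ} (h : HasMeasurableIntegral K F) (t : T) :
    Integrable F (K t) := by
  obtain ⟨C, hC⟩ := h.bounded
  exact Integrable.of_bound h.measurable.aestronglyMeasurable C (ae_of_all _ hC)

lemma HasMeasurableIntegral.of_tendsto {F : ℕ → Ω → ℝ} {G : Ω → ℝ} (C : ℝ)
    (h : ∀ n, HasMeasurableIntegral K (F n)) (hC : ∀ n ω, |F n ω| ≤ C)
    (hlim : ∀ ω, Filter.Tendsto (fun n => F n ω) Filter.atTop (nhds (G ω))) :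
    HasMeasurableIntegral K G where
  measurable := measurable_of_tendsto_metrizable (fun n => (h n).measurable)
    (tendsto_pi_nhds.2 hlim)
  bounded := ⟨C, fun ω => le_of_tendsto (hlim ω).abs (Filter.Eventually.of_forall (hC · ω))⟩
  integral := measurable_of_tendsto_metrizable (fun n => (h n).integral)
    (tendsto_pi_nhds.2 fun _ => tendsto_integral_of_dominated_convergence (fun _ => C)
      (fun n => (h n).measurable.aestronglyMeasurable) (integrable_const C)
      (fun n => ae_of_all _ (hC n)) (ae_of_all _ hlim))

lemma HasMeasurableIntegral.mul_polynomial {F g : Ω → ℝ}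
    (h : ∀ n : ℕ, HasMeasurableIntegral K (fun ω => F ω * g ω ^ n)) (p : Polynomial ℝ) :
    HasMeasurableIntegral K (fun ω => F ω * p.eval (g ω)) := by
  have hsum : (fun ω => F ω * p.eval (g ω)) =
      fun ω => ∑ n ∈ Finset.range (p.natDegree + 1), p.coeff n * (F ω * g ω ^ n) := by
    ext ω
    rw [Polynomial.eval_eq_sum_range, Finset.mul_sum]
    exact Finset.sum_congr rfl fun n _ => by ring
  rw [hsum]
  refine ⟨Finset.measurable_sum _ fun n _ => (h n).measurable.const_mul _, ?_, ?_⟩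
  · choose C hC using fun n => (h n).bounded
    refine ⟨∑ n ∈ Finset.range (p.natDegree + 1), |p.coeff n| * C n, fun ω =>
      (Finset.abs_sum_le_sum_abs _ _).trans (Finset.sum_le_sum fun n _ => ?_)⟩
    rw [abs_mul]
    exact mul_le_mul_of_nonneg_left (hC n ω) (abs_nonneg _)
  · have : (fun t => ∫ ω, ∑ n ∈ Finset.range (p.natDegree + 1), p.coeff n * (F ω * g ω ^ n) ∂K t)
        = fun t => ∑ n ∈ Finset.range (p.natDegree + 1), p.coeff n * ∫ ω, F ω * g ω ^ n ∂K t := by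
      ext t
      rw [integral_finsetSum _ fun n _ => ((h n).integrable t).const_mul _]
      exact Finset.sum_congr rfl fun n _ => integral_const_mul _ _
    rw [this]
    exact Finset.measurable_sum _ fun n _ => (h n).integral.const_mul _

/-- Weierstrass approximation, within `1 / (n + 1)`, of the continuous ramps `min 1 (max 0 (n (x -
a)))`. The ramps lie in `[0, 1]` and the error is at most `1`, whence the bound `2`. -/
lemma exists_polynomial_tendsto_indicator_Ioi (a : ℝ) :
    ∃ p : ℕ → Polynomial ℝ, (∀ n, ∀ x ∈ Set.Icc (0 : ℝ) 1, |(p n).eval x| ≤ 2) ∧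
      ∀ x ∈ Set.Icc (0 : ℝ) 1, Filter.Tendsto (fun n => (p n).eval x) Filter.atTop
        (nhds (if a < x then 1 else 0)) := by
  let φ : ℕ → ℝ → ℝ := fun n x => min 1 (max 0 (n * (x - a)))
  have hφ : ∀ n, Continuous (φ n) := fun n => by fun_prop
  have hφ1 : ∀ n x, |φ n x| ≤ 1 := fun n x => by
    rw [abs_of_nonneg (le_min zero_le_one (le_max_left _ _))]
    exact min_le_left _ _
  choose p hp using fun n : ℕ => exists_polynomial_near_of_continuousOn 0 1 (φ n)
    (hφ n).continuousOn (1 / ((n : ℝ) + 1)) (by positivity)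
  have hlt : ∀ n : ℕ, 1 / ((n : ℝ) + 1) ≤ 1 := fun n => by
    rw [div_le_one (by positivity)]
    linarith [n.cast_nonneg (α := ℝ)]
  refine ⟨p, fun n x hx => ?_, fun x hx => ?_⟩
  · have h1 := (hp n x hx).le.trans (hlt n)
    have h2 := hφ1 n x
    rw [abs_le] at *
    constructor <;> linarith
  · have h1 : Filter.Tendsto (fun n => φ n x) Filter.atTop (nhds (if a < x then 1 else 0)) := by
      split_ifs with h
      · refine tendsto_const_nhds.congr' ?_
        obtain ⟨N, hN⟩ := exists_nat_ge (1 / (x - a))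
        filter_upwards [Filter.eventually_ge_atTop N] with n hn
        have hpos : 0 < x - a := sub_pos.2 h
        have : 1 ≤ n * (x - a) := by
          rw [← div_le_iff₀ hpos]
          exact hN.trans (Nat.cast_le.2 hn)
        exact (min_eq_left (this.trans (le_max_right _ _))).symm
      · refine tendsto_const_nhds.congr fun n => ?_
        have : (n : ℝ) * (x - a) ≤ 0 :=
          mul_nonpos_of_nonneg_of_nonpos n.cast_nonneg (by linarith)
        simp [φ, max_eq_left this]
    have h2 : Filter.Tendsto (fun n => (p n).eval x - φ n x) Filter.atTop (nhds 0) :=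
      squeeze_zero_norm (fun n => (hp n x hx).le) tendsto_one_div_add_atTop_nhds_zero_nat
    simpa using h2.add h1

/-- The spare factor `F` makes the step repeatable: indicators of superlevel sets can be multiplied
on one after another. -/
lemma HasMeasurableIntegral.mul_indicator_Ioi {F g : Ω → ℝ}
    (h : ∀ n : ℕ, HasMeasurableIntegral K (fun ω => F ω * g ω ^ n))
    (hg : ∀ ω, g ω ∈ Set.Icc (0 : ℝ) 1) (a : ℝ) :
    HasMeasurableIntegral K (fun ω => F ω * if a < g ω then 1 else 0) := by
  obtain ⟨p, hp, hlim⟩ := exists_polynomial_tendsto_indicator_Ioi a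
  obtain ⟨C, hC⟩ := (h 0).bounded
  refine .of_tendsto (C * 2) (fun n => mul_polynomial h (p n)) (fun n ω => ?_)
    fun ω => (hlim _ (hg ω)).const_mul _
  rw [abs_mul]
  have h1 := hC ω
  rw [pow_zero, mul_one] at h1
  exact mul_le_mul h1 (hp n _ (hg ω)) (abs_nonneg _) ((abs_nonneg _).trans h1)

/-- A functional monotone class theorem: a family of probability measures is measurable as soon
as the integrals of a multiplicatively closed class of `[0, 1]`-valued functions, generating the
σ-algebra, are measurable. -/
theorem measurable_of_measurable_lintegral_submonoid (M : Submonoid (Ω → ℝ≥0∞))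
    (hM : ∀ f ∈ M, Measurable f) (hM1 : ∀ f ∈ M, ∀ ω, f ω ≤ 1)
    (hgen : mΩ ≤ ⨆ f : M, (borel ℝ≥0∞).comap f.1)
    (hK : ∀ f ∈ M, Measurable fun t => ∫⁻ ω, f ω ∂K t) : Measurable K := by
  have hne : ∀ f ∈ M, ∀ ω, f ω ≠ ∞ := fun f hf ω =>
    ((hM1 f hf ω).trans_lt ENNReal.one_lt_top).ne
  have hbase : ∀ f ∈ M, HasMeasurableIntegral K (fun ω => (f ω).toReal) := fun f hf => by
    refine ⟨(hM f hf).ennreal_toReal, ⟨1, fun ω => ?_⟩, ?_⟩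
    · rw [abs_of_nonneg ENNReal.toReal_nonneg]
      exact ENNReal.toReal_le_of_le_ofReal zero_le_one (by simpa using hM1 f hf ω)
    · have : (fun t => ∫ ω, (f ω).toReal ∂K t) = fun t => (∫⁻ ω, f ω ∂K t).toReal := by
        ext t
        exact integral_toReal (hM f hf).aemeasurable
          (ae_of_all _ fun ω => (hne f hf ω).lt_top)
      rw [this]
      exact (hK f hf).ennreal_toReal
  -- Quantifying over all `f ∈ M` is what carries the induction: powers of the next generator are
  -- absorbed into `f`, since `M` is multiplicatively closed.
  have hlist : ∀ l : List (M × ℝ), ∀ f ∈ M, HasMeasurableIntegral K (fun ω => (f ω).toReal *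
      if ∀ q ∈ l, q.2 < (q.1.1 ω).toReal then 1 else 0) := by
    intro l
    induction l with
    | nil => intro f hf; simpa using hbase f hf
    | cons q l ih =>
      intro f hf
      have h : ∀ n : ℕ, HasMeasurableIntegral K (fun ω => ((f ω).toReal *
          if ∀ q ∈ l, q.2 < (q.1.1 ω).toReal then 1 else 0) * (q.1.1 ω).toReal ^ n) := by
        intro n
        convert ih (f * q.1.1 ^ n) (M.mul_mem hf (M.pow_mem q.1.2 n)) using 2 with ω
        simp only [Pi.mul_apply, Pi.pow_apply, ENNReal.toReal_mul, ENNReal.toReal_pow]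
        ring
      convert HasMeasurableIntegral.mul_indicator_Ioi h (fun ω => ⟨ENNReal.toReal_nonneg,
        ENNReal.toReal_le_of_le_ofReal zero_le_one (by simpa using hM1 _ q.1.2 ω)⟩) q.2
        using 2 with ω
      simp only [List.forall_mem_cons]
      by_cases h1 : q.2 < (q.1.1 ω).toReal <;>
        by_cases h2 : ∀ q ∈ l, q.2 < (q.1.1 ω).toReal
      · rw [if_pos h2, if_pos ⟨h1, h2⟩, if_pos h1, mul_one, mul_one]
      · rw [if_neg h2, if_neg fun h => h2 h.2, mul_zero, zero_mul]
      · rw [if_neg h1, if_neg fun h => h1 h.1, mul_zero, mul_zero]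
      · rw [if_neg h1, if_neg fun h => h1 h.1, mul_zero, mul_zero]
  -- Finite intersections of superlevel sets form a generating π-system; intersecting corresponds to
  -- concatenating lists.
  let C : Set (Set Ω) := {s | ∃ l : List (M × ℝ), s = {ω | ∀ q ∈ l, q.2 < (q.1.1 ω).toReal}}
  have hCm : ∀ s ∈ C, MeasurableSet s := by
    rintro s ⟨l, rfl⟩
    have : {ω | ∀ q ∈ l, q.2 < (q.1.1 ω).toReal} =
        ⋂ q ∈ {q | q ∈ l}, {ω | q.2 < (q.1.1 ω).toReal} := by ext; simp
    rw [this]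
    exact MeasurableSet.biInter l.finite_toSet.countable fun q _ =>
      measurableSet_lt measurable_const (hM _ q.1.2).ennreal_toReal
  have hgenC : mΩ = MeasurableSpace.generateFrom C := by
    apply le_antisymm
    · refine hgen.trans (iSup_le fun f => ?_)
      have h1 : @Measurable _ _ (MeasurableSpace.generateFrom C) _
          (fun ω => (f.1 ω).toReal) := by
        refine measurable_of_forall_measurableSet_lt (m := MeasurableSpace.generateFrom C) fun a => ?_
        refine MeasurableSpace.measurableSet_generateFrom ⟨[(f, a)], ?_⟩
        ext; simp
      have h2 := @Measurable.ennreal_ofReal _ (MeasurableSpace.generateFrom C) _ h1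
      have h3 : (fun ω => ENNReal.ofReal (f.1 ω).toReal) = f.1 := by
        ext ω; exact ENNReal.ofReal_toReal (hne _ f.2 ω)
      rw [h3] at h2
      exact h2.comap_le
    · exact MeasurableSpace.generateFrom_le hCm
  have hpi : IsPiSystem C := by
    rintro _ ⟨l, rfl⟩ _ ⟨l', rfl⟩ -
    refine ⟨l ++ l', ?_⟩
    ext ω
    simp only [Set.mem_inter_iff, Set.mem_ofPred_eq, List.mem_append, or_imp, forall_and]
  refine .measure_of_isPiSystem_of_isProbabilityMeasure hgenC hpi fun s hs => ?_
  obtain ⟨l, rfl⟩ := id hs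
  have h := (hlist l 1 M.one_mem).integral.ennreal_ofReal
  convert h using 2 with t
  have : (fun ω => ((1 : Ω → ℝ≥0∞) ω).toReal *
      if ∀ q ∈ l, q.2 < (q.1.1 ω).toReal then (1 : ℝ) else 0) =
      Set.indicator {ω | ∀ q ∈ l, q.2 < (q.1.1 ω).toReal} 1 := by
    ext ω
    by_cases h : ∀ q ∈ l, q.2 < (q.1.1 ω).toReal
    · rw [if_pos h, Set.indicator_of_mem (by exact h)]
      simp
    · rw [if_neg h, Set.indicator_of_notMem (by exact h), mul_zero]
  rw [this, integral_indicator_one (hCm _ hs), ofReal_measureReal]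

/-- Probability measures agreeing on a multiplicatively closed class of `[0, 1]`-valued functions
that generates the σ-algebra are equal. -/
theorem ext_of_lintegral_submonoid {P Q : Measure Ω} [IsProbabilityMeasure P]
    [IsProbabilityMeasure Q] (M : Submonoid (Ω → ℝ≥0∞))
    (hM : ∀ f ∈ M, Measurable f) (hM1 : ∀ f ∈ M, ∀ ω, f ω ≤ 1)
    (hgen : mΩ ≤ ⨆ f : M, (borel ℝ≥0∞).comap f.1)
    (hPQ : ∀ f ∈ M, ∫⁻ ω, f ω ∂P = ∫⁻ ω, f ω ∂Q) : P = Q := by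
  -- For the trivial σ-algebra on the index set, a measurable family is constant; so the
  -- measurability theorem for the family `P, Q` already says `P = Q`.
  let _ : MeasurableSpace Bool := ⊥
  let K : Bool → Measure Ω := fun b => cond b P Q
  have : ∀ b, IsProbabilityMeasure (K b) := by rintro (_ | _) <;> assumption
  have hK : Measurable K := measurable_of_measurable_lintegral_submonoid M hM hM1 hgen
    fun f hf => by
      have : (fun b => ∫⁻ ω, f ω ∂K b) = fun _ => ∫⁻ ω, f ω ∂P := by
        ext b
        cases b
        · exact (hPQ f hf).symm
        · rfl
      rw [this]
      exact measurable_const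
  ext s hs
  have h := ((Measure.measurable_coe hs).comp hK) (measurableSet_singleton (P s))
  rcases MeasurableSpace.measurableSet_bot_iff.1 h with h | h
  · have : true ∈ (∅ : Set Bool) := h ▸ rfl
    exact this.elim
  · have : false ∈ (Set.univ : Set Bool) := trivial
    rw [← h] at this
    exact this.symm

end MonotoneClass

/-! ### Poisson processes with finite intensity: Laplace functional and Mecke formula. -/

section FinitePoisson

variable {E : Type*} [MeasurableSpace E]

lemma lintegral_sum_dirac {n : ℕ} (x : Fin n → E) {f : E → ℝ≥0∞} (hf : Measurable f) :
    ∫⁻ y, f y ∂(∑ i, Measure.dirac (x i)) = ∑ i, f (x i) := by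
  rw [lintegral_finsetSum_measure]
  exact Finset.sum_congr rfl fun i _ => lintegral_dirac' _ hf

lemma measurable_add_dirac :
    Measurable (fun p : Measure E × E => p.1 + Measure.dirac p.2) := by
  refine Measure.measurable_of_measurable_coe _ fun s hs => ?_
  simp only [Measure.add_apply]
  exact ((Measure.measurable_coe hs).comp measurable_fst).add
    ((Measure.measurable_coe hs).comp (Measure.measurable_dirac.comp measurable_snd))

lemma measurable_measure_add : Measurable (fun p : Measure E × Measure E => p.1 + p.2) := by
  refine Measure.measurable_of_measurable_coe _ fun s hs => ?_
  simp only [Measure.add_apply]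
  exact ((Measure.measurable_coe hs).comp measurable_fst).add
    ((Measure.measurable_coe hs).comp measurable_snd)

lemma lintegral_finitePoisson (lam : Measure E) {F : Measure E → ℝ≥0∞} (hF : Measurable F) :
    ∫⁻ μ, F μ ∂finitePoisson lam = ∑' n : ℕ,
      ENNReal.ofReal (Real.exp (-(lam Set.univ).toReal) / (n.factorial : ℝ)) *
        ∫⁻ x, F (∑ i, Measure.dirac (x i)) ∂(Measure.pi fun _ : Fin n => lam) := by
  rw [finitePoisson, lintegral_sum_measure]
  refine tsum_congr fun n => ?_
  rw [lintegral_smul_measure, lintegral_map hF (measurable_sum_dirac n), smul_eq_mul]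

lemma lintegral_pi_fin_succ (lam : Measure E) [SigmaFinite lam] {n : ℕ} (i : Fin (n + 1))
    {F : (Fin (n + 1) → E) → ℝ≥0∞} (hF : Measurable F) :
    ∫⁻ x, F x ∂(Measure.pi fun _ : Fin (n + 1) => lam) =
      ∫⁻ y, ∫⁻ x, F (i.insertNth y x) ∂(Measure.pi fun _ : Fin n => lam) ∂lam := by
  have h := (measurePreserving_piFinSuccAbove (fun _ : Fin (n + 1) => lam) i).symm
  rw [← h.lintegral_comp hF, lintegral_prod]
  · rfl
  · exact (hF.comp h.measurable).aemeasurable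

lemma lintegral_pi_prod (lam : Measure E) [SigmaFinite lam] {φ : E → ℝ≥0∞} (hφ : Measurable φ)
    (n : ℕ) : ∫⁻ x, ∏ i, φ (x i) ∂(Measure.pi fun _ : Fin n => lam) = (∫⁻ y, φ y ∂lam) ^ n := by
  induction n with
  | zero => simp
  | succ n ih =>
    have hm : ∀ n, Measurable fun x : Fin n → E => ∏ i, φ (x i) := fun n =>
      Finset.measurable_prod _ fun i _ => hφ.comp (measurable_pi_apply i)
    rw [lintegral_pi_fin_succ lam 0 (hm _)]
    simp only [Fin.prod_univ_succAbove _ 0, Fin.insertNth_apply_same,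
      Fin.insertNth_apply_succAbove]
    have h : ∀ y, ∫⁻ x : Fin n → E, φ y * ∏ i, φ (x i) ∂(Measure.pi fun _ : Fin n => lam) =
        φ y * (∫⁻ y, φ y ∂lam) ^ n := fun y => by rw [lintegral_const_mul _ (hm n), ih]
    rw [lintegral_congr h]
    rw [lintegral_mul_const _ hφ, pow_succ']

lemma tsum_ofReal_exp_neg_div_factorial_mul {a : ℝ} {b : ℝ≥0∞} (hb : b ≠ ∞) :
    ∑' n : ℕ, ENNReal.ofReal (Real.exp (-a) / (n.factorial : ℝ)) * b ^ n =
      ENNReal.ofReal (Real.exp (b.toReal - a)) := by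
  have hs := (NormedSpace.expSeries_div_hasSum_exp (𝔸 := ℝ) b.toReal).mul_left (Real.exp (-a))
  rw [← Real.exp_eq_exp_ℝ, ← Real.exp_add, neg_add_eq_sub] at hs
  rw [← hs.tsum_eq, ENNReal.ofReal_tsum_of_nonneg (fun n => by positivity) hs.summable]
  refine tsum_congr fun n => ?_
  rw [← ENNReal.ofReal_toReal hb, ← ENNReal.ofReal_pow ENNReal.toReal_nonneg,
    ← ENNReal.ofReal_mul (by positivity), ENNReal.ofReal_toReal hb]
  congr 1
  ring

/-- The `n`-point term factorizes into `(∫ e^{-f} dlam)^n`, and the exponential series sums to `exp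
(∫ e^{-f} dlam - lam(E))`. -/
lemma lintegral_negExp_finitePoisson (lam : Measure E) [IsFiniteMeasure lam] {f : E → ℝ≥0∞}
    (hf : Measurable f) :
    ∫⁻ μ, negExp (∫⁻ x, f x ∂μ) ∂finitePoisson lam =
      negExp (∫⁻ x, (1 - negExp (f x)) ∂lam) := by
  have hφ : Measurable fun x => negExp (f x) := measurable_negExp.comp hf
  have hm : Measurable fun μ : Measure E => negExp (∫⁻ x, f x ∂μ) :=
    measurable_negExp.comp (Measure.measurable_lintegral hf)
  rw [lintegral_finitePoisson _ hm]
  simp only [lintegral_sum_dirac _ hf, negExp_sum, lintegral_pi_prod lam hφ]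
  have hle : ∫⁻ x, negExp (f x) ∂lam ≤ lam Set.univ := by
    rw [← lintegral_one]
    exact lintegral_mono fun x => negExp_le_one _
  have hb : ∫⁻ x, negExp (f x) ∂lam ≠ ∞ := (hle.trans_lt (measure_lt_top _ _)).ne
  rw [tsum_ofReal_exp_neg_div_factorial_mul hb, lintegral_sub hφ hb
    (ae_of_all _ fun x => negExp_le_one _), lintegral_one,
    ← ENNReal.ofReal_toReal (ENNReal.sub_ne_top (measure_ne_top lam Set.univ)),
    negExp_ofReal ENNReal.toReal_nonneg, ENNReal.toReal_sub_of_le hle (measure_ne_top _ _),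
    neg_sub]

/-- In the term with `n + 1` points, each point contributes equally by symmetry. Splitting one off
leaves an `n`-point configuration, and the factor `n + 1` turns the weight `e^{-lam(E)} / (n + 1)!`
into `e^{-lam(E)} / n!`. -/
lemma mecke_finitePoisson (lam : Measure E) [IsFiniteMeasure lam] {g : E → ℝ≥0∞}
    (hg : Measurable g) {F : Measure E → ℝ≥0∞} (hF : Measurable F) :
    ∫⁻ μ, (∫⁻ x, g x ∂μ) * F μ ∂finitePoisson lam =
      ∫⁻ x, g x * ∫⁻ μ, F (μ + Measure.dirac x) ∂finitePoisson lam ∂lam := by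
  have hFx : ∀ x, Measurable fun μ => F (μ + Measure.dirac x) := fun x =>
    hF.comp (measurable_add_dirac.comp (measurable_id.prodMk measurable_const))
  have hFxn : ∀ n, Measurable fun p : E × (Fin n → E) =>
      F (∑ i, Measure.dirac (p.2 i) + Measure.dirac p.1) := fun n =>
    hF.comp (measurable_add_dirac.comp
      (((measurable_sum_dirac n).comp measurable_snd).prodMk measurable_fst))
  let c : ℕ → ℝ≥0∞ := fun n =>
    ENNReal.ofReal (Real.exp (-(lam Set.univ).toReal) / (n.factorial : ℝ))
  have hc : ∀ n, c (n + 1) * ((n + 1 : ℕ) : ℝ≥0∞) = c n := fun n => by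
    simp only [c]
    rw [← ENNReal.ofReal_natCast, ← ENNReal.ofReal_mul (by positivity), Nat.factorial_succ]
    congr 1
    push_cast
    field_simp
  have hterm : ∀ n, ∫⁻ x, (∫⁻ y, g y ∂(∑ i, Measure.dirac (x i))) *
      F (∑ i, Measure.dirac (x i)) ∂(Measure.pi fun _ : Fin (n + 1) => lam) =
      ((n + 1 : ℕ) : ℝ≥0∞) * ∫⁻ y, g y * ∫⁻ x, F (∑ i, Measure.dirac (x i) + Measure.dirac y)
        ∂(Measure.pi fun _ : Fin n => lam) ∂lam := by
    intro n
    simp only [lintegral_sum_dirac _ hg, Finset.sum_mul]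
    have hm : ∀ i : Fin (n + 1), Measurable fun x : Fin (n + 1) → E =>
        g (x i) * F (∑ i, Measure.dirac (x i)) := fun i =>
      (hg.comp (measurable_pi_apply i)).mul (hF.comp (measurable_sum_dirac _))
    rw [lintegral_finsetSum _ fun i _ => hm i, Finset.sum_congr rfl fun i _ => ?_,
      Finset.sum_const, Finset.card_univ, Fintype.card_fin, nsmul_eq_mul]
    rw [lintegral_pi_fin_succ lam i (hm i)]
    refine lintegral_congr fun y => ?_
    have hy : Measurable fun x : Fin n → E => F (∑ i, Measure.dirac (x i) + Measure.dirac y) :=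
      ((hFxn n).comp (measurable_prodMk_left (x := y)) :)
    rw [← lintegral_const_mul _ hy]
    refine lintegral_congr fun x => ?_
    rw [Fin.insertNth_apply_same, Fin.sum_univ_succAbove _ i, Fin.insertNth_apply_same, add_comm]
    simp only [Fin.insertNth_apply_succAbove]
  have hgF : Measurable fun μ => (∫⁻ x, g x ∂μ) * F μ :=
    (Measure.measurable_lintegral hg).mul hF
  rw [lintegral_finitePoisson _ hgF,
    tsum_eq_zero_add' ENNReal.summable]
  simp only [hterm]
  have h0 : ∫⁻ x, (∫⁻ y, g y ∂(∑ i, Measure.dirac (x i))) * F (∑ i, Measure.dirac (x i))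
      ∂(Measure.pi fun _ : Fin 0 => lam) = 0 := by simp
  rw [h0, mul_zero, zero_add]
  simp only [lintegral_finitePoisson _ (hFx _), ← ENNReal.tsum_mul_left]
  have hI : ∀ n, Measurable fun x => ∫⁻ y : Fin n → E,
      F (∑ i, Measure.dirac (y i) + Measure.dirac x) ∂(Measure.pi fun _ : Fin n => lam) :=
    fun n => (hFxn n).lintegral_prod_right'
  have hgI : ∀ n, Measurable fun x => g x * ∫⁻ y : Fin n → E,
      F (∑ i, Measure.dirac (y i) + Measure.dirac x) ∂(Measure.pi fun _ : Fin n => lam) :=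
    fun n => hg.mul (hI n)
  have hcI : ∀ n, Measurable fun x => g x * (c n * ∫⁻ y : Fin n → E,
      F (∑ i, Measure.dirac (y i) + Measure.dirac x) ∂(Measure.pi fun _ : Fin n => lam)) :=
    fun n => hg.mul ((hI n).const_mul _)
  rw [lintegral_tsum fun n => (hcI n).aemeasurable]
  refine tsum_congr fun n => ?_
  rw [← mul_assoc]
  change c (n + 1) * ((n + 1 : ℕ) : ℝ≥0∞) * _ = _
  rw [hc, ← lintegral_const_mul _ (hgI n)]
  exact lintegral_congr fun x => mul_left_comm _ _ _

end FinitePoisson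

/-! ### Integration against countable products, one coordinate at a time. -/

section InfiniteProduct

lemma measurable_update_prod {E : Type*} [MeasurableSpace E] (n : ℕ) :
    Measurable fun p : E × (ℕ → E) => Function.update p.2 n p.1 := by
  refine measurable_pi_lambda _ fun k => ?_
  by_cases h : k = n
  · subst h; simpa using measurable_fst
  · simp only [Function.update_of_ne h]
    exact (measurable_pi_apply k).comp measurable_snd

variable {E : Type*} [MeasurableSpace E] (P : ℕ → Measure E) [∀ n, IsProbabilityMeasure (P n)]

/-- Resampling one coordinate of a sequence of independent random variables. -/
lemma infinitePi_eq_map_update (n : ℕ) :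
    ((P n).prod (Measure.infinitePi P)).map (fun p => Function.update p.2 n p.1) =
      Measure.infinitePi P := by
  refine Measure.eq_infinitePi P fun s t ht => ?_
  rw [Measure.map_apply (measurable_update_prod n) (MeasurableSet.pi s.countable_toSet fun i _ => ht i)]
  by_cases h : n ∈ s
  · have : (fun p : E × (ℕ → E) => Function.update p.2 n p.1) ⁻¹' (Set.pi s t) =
        t n ×ˢ Set.pi (s.erase n : Finset ℕ) t := by
      ext p
      simp only [Set.mem_preimage, Set.mem_pi, Set.mem_prod, Finset.coe_erase, Finset.mem_coe,
        Set.mem_sdiff, Set.mem_singleton_iff]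
      constructor
      · intro H
        refine ⟨by simpa using H n h, fun i hi => ?_⟩
        simpa [Function.update_of_ne hi.2] using H i hi.1
      · rintro ⟨h1, h2⟩ i hi
        by_cases hin : i = n
        · subst hin; simpa using h1
        · simpa [Function.update_of_ne hin] using h2 i ⟨hi, hin⟩
    rw [this, Measure.prod_prod, Measure.infinitePi_pi P fun i _ => ht i,
      Finset.mul_prod_erase s (fun i => P i (t i)) h]
  · have : (fun p : E × (ℕ → E) => Function.update p.2 n p.1) ⁻¹' (Set.pi s t) =
        Set.univ ×ˢ Set.pi s t := by
      ext p
      simp only [Set.mem_preimage, Set.mem_pi, Set.mem_prod, Finset.mem_coe, Set.mem_univ,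
        true_and]
      refine forall₂_congr fun i hi => ?_
      rw [Function.update_of_ne (fun e : i = n => h (e ▸ hi))]
    rw [this, Measure.prod_prod, Measure.infinitePi_pi P fun i _ => ht i, measure_univ, one_mul]

lemma lintegral_infinitePi_update (n : ℕ) {F : (ℕ → E) → ℝ≥0∞} (hF : Measurable F) :
    ∫⁻ N, F N ∂(Measure.infinitePi P) =
      ∫⁻ N, ∫⁻ y, F (Function.update N n y) ∂(P n) ∂(Measure.infinitePi P) := by
  conv_lhs => rw [← infinitePi_eq_map_update P n]
  rw [lintegral_map hF (measurable_update_prod n), lintegral_prod_symm']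
  exact hF.comp (measurable_update_prod n)

lemma lintegral_infinitePi_prod {f : ℕ → E → ℝ≥0∞} (hf : ∀ n, Measurable (f n)) (n : ℕ) :
    ∫⁻ N, ∏ i ∈ Finset.range n, f i (N i) ∂(Measure.infinitePi P) =
      ∏ i ∈ Finset.range n, ∫⁻ y, f i y ∂(P i) := by
  have hm : ∀ n, Measurable fun N : ℕ → E => ∏ i ∈ Finset.range n, f i (N i) := fun n =>
    Finset.measurable_prod _ fun i _ => (hf i).comp (measurable_pi_apply i)
  induction n with
  | zero => simp
  | succ n ih =>
    rw [lintegral_infinitePi_update P n (hm _), Finset.prod_range_succ, ← ih,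
      ← lintegral_mul_const _ (hm n)]
    refine lintegral_congr fun N => ?_
    rw [← lintegral_const_mul _ (hf n)]
    refine lintegral_congr fun y => ?_
    rw [Finset.prod_range_succ, Function.update_self]
    congr 1
    refine Finset.prod_congr rfl fun i hi => ?_
    rw [Function.update_of_ne (Finset.mem_range.1 hi).ne]

end InfiniteProduct

/-! ### Laplace functional and Mecke formula for s-finite intensities. -/

section PoissonRandomMeasure

variable {E : Type*} [MeasurableSpace E]

lemma lintegral_poissonRandomMeasure (lam : Measure E) [SFinite lam] {F : Measure E → ℝ≥0∞}
    (hF : Measurable F) : ∫⁻ μ, F μ ∂poissonRandomMeasure lam =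
      ∫⁻ N, F (Measure.sum N) ∂(Measure.infinitePi fun n => finitePoisson (sfiniteSeq lam n)) :=
  lintegral_map hF measurable_measure_sum

lemma lintegral_eq_tsum_sfiniteSeq (lam : Measure E) [SFinite lam] (f : E → ℝ≥0∞) :
    ∫⁻ x, f x ∂lam = ∑' n, ∫⁻ x, f x ∂(sfiniteSeq lam n) := by
  conv_lhs => rw [← sum_sfiniteSeq lam]
  exact lintegral_sum_measure _ _

lemma tendsto_negExp_tsum (a : ℕ → ℝ≥0∞) :
    Filter.Tendsto (fun n => ∏ i ∈ Finset.range n, negExp (a i)) Filter.atTop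
      (nhds (negExp (∑' i, a i))) := by
  simp only [← negExp_sum]
  exact (continuous_negExp.tendsto _).comp (ENNReal.tendsto_nat_tsum a)

/-- The Laplace functional of a Poisson random measure. -/
theorem lintegral_negExp_poissonRandomMeasure (lam : Measure E) [SFinite lam] {f : E → ℝ≥0∞}
    (hf : Measurable f) :
    ∫⁻ μ, negExp (∫⁻ x, f x ∂μ) ∂poissonRandomMeasure lam =
      negExp (∫⁻ x, (1 - negExp (f x)) ∂lam) := by
  have hm : Measurable fun μ : Measure E => negExp (∫⁻ x, f x ∂μ) :=
    measurable_negExp.comp (Measure.measurable_lintegral hf)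
  rw [lintegral_poissonRandomMeasure _ hm]
  rw [lintegral_eq_tsum_sfiniteSeq lam]
  simp only [lintegral_sum_measure]
  -- Both sides are limits of the same finite products: the right by continuity of `negExp`, the
  -- left by independence and dominated convergence with bound `1`.
  refine tendsto_nhds_unique ?_ (tendsto_negExp_tsum _)
  simp only [← lintegral_negExp_finitePoisson _ hf]
  simp only [← lintegral_infinitePi_prod (fun n => finitePoisson (sfiniteSeq lam n)) (fun _ => hm)]
  refine tendsto_lintegral_of_dominated_convergence (fun _ => 1) (fun n => ?_) (fun n => ?_)
    (by simp) (ae_of_all _ fun N => tendsto_negExp_tsum _)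
  · exact Finset.measurable_prod _ fun i _ => hm.comp (measurable_pi_apply i)
  · exact ae_of_all _ fun N => Finset.prod_le_one' fun i _ => negExp_le_one _

/-- Isolates one summand of the superposition, so that adding a point to that summand is the same as
adding it to the total. -/
lemma measure_sum_update (N : ℕ → Measure E) (n : ℕ) (ν : Measure E) :
    Measure.sum (Function.update N n ν) = Measure.sum (Function.update N n 0) + ν := by
  ext s hs
  rw [Measure.add_apply, Measure.sum_apply _ hs, Measure.sum_apply _ hs]
  have h : ∀ i, Function.update N n ν i s =
      Function.update N n 0 i s + if i = n then ν s else 0 := fun i => by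
    by_cases h : i = n
    · subst h; simp
    · simp [h]
  rw [tsum_congr h, ENNReal.tsum_add, tsum_ite_eq]

/-- The Mecke formula for a Poisson random measure. -/
theorem mecke_poissonRandomMeasure (lam : Measure E) [SFinite lam] {g : E → ℝ≥0∞}
    (hg : Measurable g) {F : Measure E → ℝ≥0∞} (hF : Measurable F) :
    ∫⁻ μ, (∫⁻ x, g x ∂μ) * F μ ∂poissonRandomMeasure lam =
      ∫⁻ x, g x * ∫⁻ μ, F (μ + Measure.dirac x) ∂poissonRandomMeasure lam ∂lam := by
  set P : ℕ → Measure (Measure E) := fun n => finitePoisson (sfiniteSeq lam n)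
  have hFx : ∀ x, Measurable fun μ => F (μ + Measure.dirac x) := fun x =>
    hF.comp (measurable_add_dirac.comp (measurable_id.prodMk measurable_const))
  have hFs : Measurable fun N : ℕ → Measure E => F (Measure.sum N) :=
    hF.comp measurable_measure_sum
  have hgm := Measure.measurable_lintegral hg
  have hFxN : Measurable fun p : E × (ℕ → Measure E) =>
      F (Measure.sum p.2 + Measure.dirac p.1) :=
    hF.comp (measurable_add_dirac.comp
      ((measurable_measure_sum.comp measurable_snd).prodMk measurable_fst))
  have hgFs : ∀ n, Measurable fun N : ℕ → Measure E => (∫⁻ x, g x ∂(N n)) * F (Measure.sum N) :=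
    fun n => (hgm.comp (measurable_pi_apply n)).mul hFs
  have hgF : Measurable fun μ => (∫⁻ x, g x ∂μ) * F μ := hgm.mul hF
  -- The finite Mecke formula is applied to the `n`-th component with the others frozen; the `n`-th
  -- coordinate is resampled beforehand and merged again afterwards. Summing over `n` gives the
  -- theorem.
  have key : ∀ n, ∫⁻ N, (∫⁻ x, g x ∂(N n)) * F (Measure.sum N) ∂(Measure.infinitePi P) =
      ∫⁻ x, g x * ∫⁻ N, F (Measure.sum N + Measure.dirac x) ∂(Measure.infinitePi P)
        ∂(sfiniteSeq lam n) := by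
    intro n
    have hup : ∀ p : Measure E × (ℕ → Measure E), Measure.sum (Function.update p.2 n p.1) =
        Measure.sum (Function.update p.2 n 0) + p.1 := fun p => measure_sum_update _ _ _
    have hm3 : Measurable fun p : (ℕ → Measure E) × E × Measure E =>
        F (Measure.sum (Function.update p.1 n p.2.2) + Measure.dirac p.2.1) :=
      (hFxN.comp ((measurable_fst.comp measurable_snd).prodMk ((measurable_update_prod n).comp
        ((measurable_snd.comp measurable_snd).prodMk measurable_fst))) :)
    have hG : ∀ N : ℕ → Measure E, Measurable fun ν => F (Measure.sum (Function.update N n ν)) :=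
      fun N => (hFs.comp ((measurable_update_prod n).comp (measurable_prodMk_right (y := N))) :)
    rw [lintegral_infinitePi_update P n (hgFs n)]
    simp only [Function.update_self]
    have h1 : ∀ N : ℕ → Measure E,
        ∫⁻ ν, (∫⁻ x, g x ∂ν) * F (Measure.sum (Function.update N n ν)) ∂(P n) =
        ∫⁻ x, g x * ∫⁻ ν, F (Measure.sum (Function.update N n ν) + Measure.dirac x) ∂(P n)
          ∂(sfiniteSeq lam n) := fun N => by
      rw [mecke_finitePoisson _ hg (hG N)]
      refine lintegral_congr fun x => ?_
      congr 1
      refine lintegral_congr fun ν => ?_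
      rw [measure_sum_update N n (ν + _), ← add_assoc, ← measure_sum_update]
    rw [lintegral_congr h1, lintegral_lintegral_swap]
    · refine lintegral_congr fun x => ?_
      have hx : Measurable fun N : ℕ → Measure E => F (Measure.sum N + Measure.dirac x) :=
        (hFxN.comp (measurable_prodMk_left (x := x)) :)
      rw [lintegral_infinitePi_update P n hx,
        ← lintegral_const_mul]
      have hm4 : Measurable fun p : (ℕ → Measure E) × Measure E =>
          F (Measure.sum (Function.update p.1 n p.2) + Measure.dirac x) :=
        (hm3.comp (measurable_fst.prodMk
          ((measurable_const (a := x)).prodMk measurable_snd)) :)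
      exact hm4.lintegral_prod_right'
    · refine Measurable.aemeasurable ?_
      refine (hg.comp measurable_snd).mul ?_
      have hm4 : Measurable fun p : ((ℕ → Measure E) × E) × Measure E =>
          F (Measure.sum (Function.update p.1.1 n p.2) + Measure.dirac p.1.2) :=
        (hm3.comp ((measurable_fst.comp measurable_fst).prodMk
          ((measurable_snd.comp measurable_fst).prodMk measurable_snd)) :)
      exact hm4.lintegral_prod_right'
  rw [lintegral_poissonRandomMeasure _ hgF]
  simp only [lintegral_poissonRandomMeasure _ (hFx _)]
  rw [lintegral_eq_tsum_sfiniteSeq lam]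
  simp only [lintegral_sum_measure, ← ENNReal.tsum_mul_right]
  rw [lintegral_tsum fun n => (hgFs n).aemeasurable]
  exact tsum_congr key

/-- The intensity measure of a Poisson random measure. -/
lemma lintegral_lintegral_poissonRandomMeasure (lam : Measure E) [SFinite lam] {g : E → ℝ≥0∞}
    (hg : Measurable g) :
    ∫⁻ μ, ∫⁻ x, g x ∂μ ∂poissonRandomMeasure lam = ∫⁻ x, g x ∂lam := by
  simpa using mecke_poissonRandomMeasure lam hg (F := fun _ => 1) measurable_const

end PoissonRandomMeasure

/-! ### Laplace functionals determine laws and measurability of random measures. -/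

section TestFunctions

variable {X : Type*} [MetricSpace X] [MeasurableSpace X]

/-- Bounded measurable functions with bounded support. -/
structure IsTest (f : X → ℝ≥0∞) : Prop where
  measurable : Measurable f
  le_indicator : ∃ C : ℝ≥0∞, C ≠ ∞ ∧ ∃ B : Set X, Bornology.IsBounded B ∧ MeasurableSet B ∧
    ∀ x, f x ≤ B.indicator (fun _ => C) x

lemma IsTest.zero : IsTest (0 : X → ℝ≥0∞) :=
  ⟨measurable_zero, 0, ENNReal.zero_ne_top, ∅, Bornology.isBounded_empty, MeasurableSet.empty,
    fun _ => zero_le⟩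

lemma IsTest.add {f g : X → ℝ≥0∞} (hf : IsTest f) (hg : IsTest g) : IsTest (f + g) := by
  obtain ⟨C, hC, B, hB, hBm, h⟩ := hf.le_indicator
  obtain ⟨C', hC', B', hB', hBm', h'⟩ := hg.le_indicator
  refine ⟨hf.measurable.add hg.measurable, C + C', ENNReal.add_ne_top.2 ⟨hC, hC'⟩, B ∪ B',
    hB.union hB', hBm.union hBm', fun x => (add_le_add (h x) (h' x)).trans ?_⟩
  by_cases h1 : x ∈ B <;> by_cases h2 : x ∈ B' <;> simp [h1, h2]

lemma IsTest.indicator {B : Set X} (hB : Bornology.IsBounded B) (hBm : MeasurableSet B)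
    {C : ℝ≥0∞} (hC : C ≠ ∞) : IsTest (B.indicator fun _ => C) :=
  ⟨measurable_const.indicator hBm, C, hC, B, hB, hBm, fun _ => le_rfl⟩

lemma IsTest.ne_top {f : X → ℝ≥0∞} (hf : IsTest f) (x : X) : f x ≠ ∞ := by
  obtain ⟨C, hC, B, -, -, h⟩ := hf.le_indicator
  refine ne_top_of_le_ne_top hC ((h x).trans ?_)
  exact Set.indicator_le_self' (fun _ _ => zero_le) x

lemma IsTest.lintegral_ne_top {f : X → ℝ≥0∞} (hf : IsTest f) (κ : LocFin X) :
    ∫⁻ x, f x ∂(κ : Measure X) ≠ ∞ := by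
  obtain ⟨C, hC, B, hB, hBm, h⟩ := hf.le_indicator
  refine ne_top_of_le_ne_top ?_ (lintegral_mono h)
  rw [lintegral_indicator_const hBm]
  exact ENNReal.mul_ne_top hC (κ.2 B hB).ne

lemma measurable_lintegral_locFin {f : X → ℝ≥0∞} (hf : Measurable f) :
    Measurable fun κ : LocFin X => ∫⁻ x, f x ∂(κ : Measure X) :=
  (Measure.measurable_lintegral hf).comp measurable_subtype_coe

lemma measurable_pointMeas_coe : Measurable fun μ : PointMeas X => (μ.1 : Measure X) :=
  measurable_subtype_coe.comp measurable_subtype_coe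

/-- `negExp` has the measurable left inverse `y ↦ -log y`, so exponentials of evaluations generate
the same σ-algebra as the evaluations. -/
lemma measurable_of_negExp {Ω : Type*} {m : MeasurableSpace Ω} {Y : Ω → ℝ≥0∞}
    (h : Measurable fun ω => negExp (Y ω)) : Measurable Y := by
  have h1 : Y = fun ω => (-(ENNReal.log (negExp (Y ω)))).toENNReal := by
    ext ω
    rw [negExp, EReal.log_exp, neg_neg, EReal.toENNReal_coe]
  rw [h1]
  exact measurable_ereal_toENNReal.comp (measurable_neg.comp (ENNReal.measurable_log.comp h))

variable {Ω : Type*}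

/-- The functions `ω ↦ exp (-∫ f d(j₁ ω) - ∫ g d(j₂ ω))`, where `f` and `g` are test functions. -/
def laplaceSubmonoid (j₁ j₂ : Ω → LocFin X) : Submonoid (Ω → ℝ≥0∞) where
  carrier := {F | ∃ f g : X → ℝ≥0∞, IsTest f ∧ IsTest g ∧
    F = fun ω => negExp (∫⁻ x, f x ∂(j₁ ω : Measure X)) * negExp (∫⁻ x, g x ∂(j₂ ω : Measure X))}
  mul_mem' := by
    rintro _ _ ⟨f, g, hf, hg, rfl⟩ ⟨f', g', hf', hg', rfl⟩
    refine ⟨f + f', g + g', hf.add hf', hg.add hg', ?_⟩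
    ext ω
    simp only [Pi.mul_apply, Pi.add_apply]
    rw [lintegral_add_left hf.measurable, lintegral_add_left hg.measurable, negExp_add, negExp_add]
    ring
  one_mem' := ⟨0, 0, IsTest.zero, IsTest.zero, by ext; simp⟩

variable {j₁ j₂ : Ω → LocFin X}

lemma le_one_of_mem_laplaceSubmonoid {F : Ω → ℝ≥0∞} (hF : F ∈ laplaceSubmonoid j₁ j₂) (ω : Ω) :
    F ω ≤ 1 := by
  obtain ⟨f, g, hf, hg, rfl⟩ := hF
  exact mul_le_one' (negExp_le_one _) (negExp_le_one _)

lemma laplaceSubmonoid_self_apply {j : Ω → LocFin X} {f g : X → ℝ≥0∞} (hf : IsTest f) (ω : Ω) :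
    negExp (∫⁻ x, f x ∂(j ω : Measure X)) * negExp (∫⁻ x, g x ∂(j ω : Measure X)) =
      negExp (∫⁻ x, (f + g) x ∂(j ω : Measure X)) := by
  simp only [Pi.add_apply]
  rw [lintegral_add_left hf.measurable, negExp_add]

variable [mΩ : MeasurableSpace Ω]

lemma measurable_of_mem_laplaceSubmonoid (hj₁ : Measurable j₁) (hj₂ : Measurable j₂)
    {F : Ω → ℝ≥0∞} (hF : F ∈ laplaceSubmonoid j₁ j₂) : Measurable F := by
  obtain ⟨f, g, hf, hg, rfl⟩ := hF
  exact (measurable_negExp.comp ((measurable_lintegral_locFin hf.measurable).comp hj₁)).mul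
    (measurable_negExp.comp ((measurable_lintegral_locFin hg.measurable).comp hj₂))

variable [BorelSpace X]

lemma le_iSup_comap_laplaceSubmonoid
    (hgen : mΩ ≤ MeasurableSpace.comap j₁ inferInstance ⊔ MeasurableSpace.comap j₂ inferInstance) :
    mΩ ≤ ⨆ f : laplaceSubmonoid j₁ j₂, (borel ℝ≥0∞).comap f.1 := by
  refine hgen.trans ?_
  set m := ⨆ f : laplaceSubmonoid j₁ j₂, (borel ℝ≥0∞).comap f.1
  have hmem : ∀ F ∈ laplaceSubmonoid j₁ j₂, @Measurable _ _ m _ F := fun F hF =>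
    measurable_iff_comap_le.2 (le_iSup (fun f : laplaceSubmonoid j₁ j₂ =>
      (borel ℝ≥0∞).comap f.1) ⟨F, hF⟩)
  rw [locFin_measurableSpace_eq]
  simp only [MeasurableSpace.comap_iSup, MeasurableSpace.comap_comp]
  refine sup_le (iSup₂_le fun B hB => ?_) (iSup₂_le fun B hB => ?_)
  · refine measurable_iff_comap_le.1 (measurable_of_negExp ?_)
    refine hmem _ ⟨_, 0, IsTest.indicator hB.1 hB.2 ENNReal.one_ne_top, IsTest.zero, ?_⟩
    ext ω
    simp [lintegral_indicator_const hB.2]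
  · refine measurable_iff_comap_le.1 (measurable_of_negExp ?_)
    refine hmem _ ⟨0, _, IsTest.zero, IsTest.indicator hB.1 hB.2 ENNReal.one_ne_top, ?_⟩
    ext ω
    simp [lintegral_indicator_const hB.2]

/-- Joint Laplace functionals determine the law of a pair of random measures. -/
theorem ext_of_laplace_pair {P Q : Measure Ω} [IsProbabilityMeasure P] [IsProbabilityMeasure Q]
    (hj₁ : Measurable j₁) (hj₂ : Measurable j₂)
    (hgen : mΩ ≤ MeasurableSpace.comap j₁ inferInstance ⊔ MeasurableSpace.comap j₂ inferInstance)
    (h : ∀ f g : X → ℝ≥0∞, IsTest f → IsTest g →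
      ∫⁻ ω, negExp (∫⁻ x, f x ∂(j₁ ω : Measure X)) * negExp (∫⁻ x, g x ∂(j₂ ω : Measure X)) ∂P =
      ∫⁻ ω, negExp (∫⁻ x, f x ∂(j₁ ω : Measure X)) * negExp (∫⁻ x, g x ∂(j₂ ω : Measure X)) ∂Q) :
    P = Q := by
  refine ext_of_lintegral_submonoid (laplaceSubmonoid j₁ j₂)
    (fun f hf => measurable_of_mem_laplaceSubmonoid hj₁ hj₂ hf)
    (fun f hf => le_one_of_mem_laplaceSubmonoid hf) (le_iSup_comap_laplaceSubmonoid hgen) ?_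
  rintro _ ⟨f, g, hf, hg, rfl⟩
  exact h f g hf hg

/-- The Laplace functional determines the law of a random measure. -/
theorem ext_of_laplace {j : Ω → LocFin X} {P Q : Measure Ω} [IsProbabilityMeasure P]
    [IsProbabilityMeasure Q] (hj : Measurable j)
    (hgen : mΩ ≤ MeasurableSpace.comap j inferInstance)
    (h : ∀ f : X → ℝ≥0∞, IsTest f → ∫⁻ ω, negExp (∫⁻ x, f x ∂(j ω : Measure X)) ∂P =
      ∫⁻ ω, negExp (∫⁻ x, f x ∂(j ω : Measure X)) ∂Q) : P = Q := by
  refine ext_of_laplace_pair hj hj (hgen.trans le_sup_left) fun f g hf hg => ?_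
  simp only [laplaceSubmonoid_self_apply hf]
  exact h _ (hf.add hg)

/-- A family of laws of random measures is measurable if its Laplace functionals are. -/
theorem measurable_of_measurable_laplace {T : Type*} [MeasurableSpace T] {j : Ω → LocFin X}
    {K : T → Measure Ω} [∀ t, IsProbabilityMeasure (K t)] (hj : Measurable j)
    (hgen : mΩ ≤ MeasurableSpace.comap j inferInstance)
    (h : ∀ f : X → ℝ≥0∞, IsTest f →
      Measurable fun t => ∫⁻ ω, negExp (∫⁻ x, f x ∂(j ω : Measure X)) ∂(K t)) :
    Measurable K := by
  refine measurable_of_measurable_lintegral_submonoid (laplaceSubmonoid j j)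
    (fun f hf => measurable_of_mem_laplaceSubmonoid hj hj hf)
    (fun f hf => le_one_of_mem_laplaceSubmonoid hf)
    (le_iSup_comap_laplaceSubmonoid (hgen.trans le_sup_left)) ?_
  rintro _ ⟨f, g, hf, hg, rfl⟩
  simp only [laplaceSubmonoid_self_apply hf]
  exact h _ (hf.add hg)

end TestFunctions

/-! ### Restriction to locally finite measures; countable generation. -/

section Spaces

variable {X : Type*} [MetricSpace X] [MeasurableSpace X]

lemma sum_dirac_mem_range {n : ℕ} (x : Fin n → X) :
    (∑ i, Measure.dirac (x i)) ∈ Set.range fun μ : PointMeas X => (μ.1 : Measure X) := by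
  have hfin : IsFiniteMeasure (∑ i, Measure.dirac (x i)) := inferInstance
  refine ⟨⟨⟨∑ i, Measure.dirac (x i), fun B _ => measure_lt_top _ B⟩, fun B _ hBm => ?_⟩, rfl⟩
  classical
  refine ⟨∑ i, if x i ∈ B then 1 else 0, ?_⟩
  rw [Measure.finsetSum_apply]
  push_cast
  refine Finset.sum_congr rfl fun i _ => ?_
  rw [Measure.dirac_apply' _ hBm, Set.indicator_apply]
  rfl

variable [BorelSpace X]

lemma measurableEmbedding_locFin_coe :
    MeasurableEmbedding fun κ : LocFin X => (κ : Measure X) :=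
  MeasurableEmbedding.subtype_coe measurableSet_locFin

/-- A law carried by the locally finite measures loses no mass when pulled back to the subtype. -/
lemma lintegral_comap_locFin_coe {P : Measure (Measure X)}
    (h : ∀ᵐ κ ∂P, ∀ B : Set X, Bornology.IsBounded B → κ B < ∞) (F : Measure X → ℝ≥0∞) :
    ∫⁻ κ, F κ ∂(P.comap fun κ : LocFin X => (κ : Measure X)) = ∫⁻ κ, F κ ∂P := by
  rw [← measurableEmbedding_locFin_coe.lintegral_map, measurableEmbedding_locFin_coe.map_comap,
    Measure.restrict_eq_self_of_ae_mem]
  simpa using h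

/-- Finite expectation gives almost sure finiteness, and the countably many balls of integer radius
about one point absorb every bounded set. -/
lemma ae_locFin_of_lintegral_ne_top {P : Measure (Measure X)}
    (h : ∀ B : Set X, Bornology.IsBounded B → MeasurableSet B → ∫⁻ κ, κ B ∂P ≠ ∞) :
    ∀ᵐ κ ∂P, ∀ B : Set X, Bornology.IsBounded B → κ B < ∞ := by
  rcases isEmpty_or_nonempty X with hX | ⟨⟨x⟩⟩
  · refine ae_of_all _ fun κ B _ => ?_
    rw [Measure.eq_zero_of_isEmpty κ]
    simp
  have : ∀ᵐ κ ∂P, ∀ k : ℕ, κ (Metric.ball x k) < ∞ := ae_all_iff.2 fun k =>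
    ae_lt_top (Measure.measurable_coe Metric.isOpen_ball.measurableSet)
      (h _ Metric.isBounded_ball Metric.isOpen_ball.measurableSet)
  filter_upwards [this] with κ hκ B hB
  obtain ⟨r, hr⟩ := hB.subset_ball x
  obtain ⟨k, hk⟩ := exists_nat_ge r
  exact (measure_mono (hr.trans (Metric.ball_subset_ball hk))).trans_lt (hκ k)

variable [SecondCountableTopology X]

lemma measurableEmbedding_pointMeas_coe :
    MeasurableEmbedding fun μ : PointMeas X => (μ.1 : Measure X) :=
  measurableEmbedding_locFin_coe.comp (MeasurableEmbedding.subtype_coe measurableSet_pointMeas)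

/-- Needed for almost sure uniqueness of the Bayes kernel. The σ-algebra is pulled back from a
countable product by evaluation on a countable π-system cut down to balls. -/
instance : MeasurableSpace.CountablyGenerated (LocFin X) := by
  rcases isEmpty_or_nonempty X with hX | ⟨⟨x⟩⟩
  · have : Subsingleton (LocFin X) := ⟨fun a b => Subtype.ext (Subsingleton.elim _ _)⟩
    infer_instance
  let b := MeasurableSpace.countableGeneratingSet X
  have hgen : ‹MeasurableSpace X› = MeasurableSpace.generateFrom (generatePiSystem b) := by
    rw [generateFrom_generatePiSystem_eq, MeasurableSpace.generateFrom_countableGeneratingSet]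
  have hbc : b.Countable := MeasurableSpace.countable_countableGeneratingSet
  have hpc : (generatePiSystem b).Countable := by
    refine (Set.countable_ofPred_finite_subset hbc).image (fun t => ⋂₀ t) |>.mono ?_
    intro s hs
    induction hs with
    | base h => exact ⟨{_}, ⟨Set.finite_singleton _, by simpa using h⟩, by simp⟩
    | inter _ _ _ h1 h2 =>
      obtain ⟨t1, ⟨hf1, hs1⟩, rfl⟩ := h1
      obtain ⟨t2, ⟨hf2, hs2⟩, rfl⟩ := h2
      exact ⟨t1 ∪ t2, ⟨hf1.union hf2, Set.union_subset hs1 hs2⟩, Set.sInter_union _ _⟩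
  have hpm : ∀ s ∈ generatePiSystem b, MeasurableSet s := fun s hs => by
    rw [hgen]
    exact MeasurableSpace.measurableSet_generateFrom hs
  let ev : LocFin X → (ℕ × (insert Set.univ (generatePiSystem b) : Set (Set X)) → ℝ≥0∞) :=
    fun κ q => (κ : Measure X) (q.2 ∩ Metric.ball x q.1)
  have : Countable (insert Set.univ (generatePiSystem b) : Set (Set X)) := (hpc.insert _).to_subtype
  have hev : Measurable ev := measurable_pi_lambda _ fun q => by
    refine (Measure.measurable_coe (MeasurableSet.inter ?_ Metric.isOpen_ball.measurableSet)).comp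
      measurable_subtype_coe
    rcases q.2.2 with h | h
    · rw [h]; exact MeasurableSet.univ
    · exact hpm _ h
  have heq : (Subtype.instMeasurableSpace : MeasurableSpace (LocFin X)) =
      MeasurableSpace.comap ev inferInstance := by
    refine le_antisymm ?_ hev.comap_le
    have hcoord : ∀ q, @Measurable _ _ (MeasurableSpace.comap ev inferInstance) _
        fun κ => ev κ q := fun q => (measurable_pi_apply q).comp (comap_measurable ev)
    rw [locFin_measurableSpace_eq]
    refine iSup₂_le fun B hB => measurable_iff_comap_le.1 ?_
    obtain ⟨r, hr⟩ := hB.1.subset_ball x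
    obtain ⟨k, hk⟩ := exists_nat_ge r
    have hBk : B ⊆ Metric.ball x k := hr.trans (Metric.ball_subset_ball hk)
    let K : LocFin X → Measure X := fun κ => (κ : Measure X).restrict (Metric.ball x k)
    have hK : ∀ κ, IsFiniteMeasure (K κ) := fun κ =>
      ⟨by simpa [K] using κ.2 _ Metric.isBounded_ball⟩
    -- Restricted to a ball the measures are finite, so the π-system and the total mass suffice;
    -- `Set.univ` was included among the indices to supply the latter.
    have hKm := @Measurable.measure_of_isPiSystem _ _ (MeasurableSpace.comap ev inferInstance) _ K
      hK _ hgen (isPiSystem_generatePiSystem b) (fun s hs => by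
        simpa only [K, Measure.restrict_apply (hpm s hs)] using
          hcoord (k, ⟨s, Set.mem_insert_of_mem _ hs⟩)) (by
        simpa only [K, Measure.restrict_apply MeasurableSet.univ] using
          hcoord (k, ⟨Set.univ, Set.mem_insert _ _⟩))
    have hKB : (fun κ : LocFin X => (κ : Measure X) B) = fun κ => K κ B := by
      ext κ
      rw [Measure.restrict_apply hB.2, Set.inter_eq_left.2 hBk]
    rw [hKB]
    exact (Measure.measurable_coe hB.2).comp hKm
  rw [heq]
  exact MeasurableSpace.CountablyGenerated.comap ev

end Spaces

/-! ### The Poisson process on locally finite point measures. -/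

section PoissonProcess

variable {X : Type*} [MetricSpace X] [MeasurableSpace X] [BorelSpace X] [SecondCountableTopology X]

lemma exists_natCast_eq_tsum {a : ℕ → ℝ≥0∞} (ha : ∀ i, ∃ n : ℕ, a i = n) (h : ∑' i, a i ≠ ∞) :
    ∃ n : ℕ, ∑' i, a i = n := by
  choose n hn using ha
  simp only [hn] at h ⊢
  have hfin : (Function.support n).Finite := by
    refine (ENNReal.finite_const_le_of_tsum_ne_top h one_ne_zero).subset fun i hi => ?_
    have : 1 ≤ n i := Nat.one_le_iff_ne_zero.2 hi
    simpa using mod_cast this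
  refine ⟨∑ i ∈ hfin.toFinset, n i, ?_⟩
  rw [tsum_eq_sum (s := hfin.toFinset), Nat.cast_sum]
  intro i hi
  simpa using hi

lemma ae_finitePoisson_mem_range (lam : Measure X) :
    ∀ᵐ μ ∂finitePoisson lam, μ ∈ Set.range fun μ : PointMeas X => (μ.1 : Measure X) := by
  rw [finitePoisson, Measure.ae_sum_iff]
  refine fun n => Measure.ae_smul_measure ?_ _
  exact (ae_map_iff (p := (· ∈ Set.range fun μ : PointMeas X => (μ.1 : Measure X)))
    (measurable_sum_dirac n).aemeasurable measurableEmbedding_pointMeas_coe.measurableSet_range).2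
    (ae_of_all _ sum_dirac_mem_range)

/-- Finite mean on bounded sets gives local finiteness. Almost surely every component is a point
measure, and a convergent sum of natural numbers is a natural number. -/
lemma ae_poissonRandomMeasure_mem_range (κ : LocFin X) :
    ∀ᵐ μ ∂poissonRandomMeasure (κ : Measure X),
      μ ∈ Set.range fun μ : PointMeas X => (μ.1 : Measure X) := by
  have hfin : ∀ᵐ μ ∂poissonRandomMeasure (κ : Measure X),
      ∀ B : Set X, Bornology.IsBounded B → μ B < ∞ := by
    refine ae_locFin_of_lintegral_ne_top fun B hB hBm => ?_
    have h := lintegral_lintegral_poissonRandomMeasure (κ : Measure X)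
      (g := B.indicator 1) (measurable_one.indicator hBm)
    simp only [lintegral_indicator_one hBm] at h
    rw [h]
    exact (κ.2 B hB).ne
  have hfin' := ae_of_ae_map measurable_measure_sum.aemeasurable hfin
  have hint : ∀ᵐ N ∂Measure.infinitePi fun n => finitePoisson (sfiniteSeq (κ : Measure X) n),
      ∀ n, N n ∈ Set.range fun μ : PointMeas X => (μ.1 : Measure X) := by
    refine ae_all_iff.2 fun n => ?_
    have h := ae_finitePoisson_mem_range (sfiniteSeq (κ : Measure X) n)
    rw [← Measure.infinitePi_map_eval
      (fun n => finitePoisson (sfiniteSeq (κ : Measure X) n)) n] at h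
    exact ae_of_ae_map (measurable_pi_apply n).aemeasurable h
  refine (ae_map_iff (p := (· ∈ Set.range fun μ : PointMeas X => (μ.1 : Measure X)))
    measurable_measure_sum.aemeasurable
    measurableEmbedding_pointMeas_coe.measurableSet_range).2 ?_
  filter_upwards [hfin', hint] with N h1 h2
  refine ⟨⟨⟨Measure.sum N, h1⟩, fun B hB hBm => ?_⟩, rfl⟩
  have h3 := h1 B hB
  change ∃ n : ℕ, Measure.sum N B = n
  rw [Measure.sum_apply _ hBm] at h3 ⊢
  refine exists_natCast_eq_tsum (fun i => ?_) h3.ne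
  obtain ⟨μ, hμ⟩ := h2 i
  rw [← hμ]
  exact μ.2 B hB hBm

lemma map_coe_poissonProcess (κ : LocFin X) :
    (poissonProcess κ).map (fun μ : PointMeas X => (μ.1 : Measure X)) =
      poissonRandomMeasure (κ : Measure X) := by
  rw [poissonProcess, measurableEmbedding_pointMeas_coe.map_comap,
    Measure.restrict_eq_self_of_ae_mem (ae_poissonRandomMeasure_mem_range κ)]

lemma lintegral_poissonProcess (κ : LocFin X) (F : Measure X → ℝ≥0∞) :
    ∫⁻ μ, F μ.1 ∂(poissonProcess κ) = ∫⁻ μ, F μ ∂(poissonRandomMeasure (κ : Measure X)) := by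
  rw [← map_coe_poissonProcess, measurableEmbedding_pointMeas_coe.lintegral_map]

instance isProbabilityMeasure_poissonProcess (κ : LocFin X) :
    IsProbabilityMeasure (poissonProcess κ) := by
  constructor
  rw [← lintegral_one, lintegral_poissonProcess κ fun _ => 1, lintegral_one, measure_univ]

lemma laplace_poissonProcess (κ : LocFin X) {f : X → ℝ≥0∞} (hf : Measurable f) :
    ∫⁻ μ, negExp (∫⁻ x, f x ∂(μ.1 : Measure X)) ∂(poissonProcess κ) =
      negExp (∫⁻ x, (1 - negExp (f x)) ∂(κ : Measure X)) := by
  rw [lintegral_poissonProcess κ fun μ => negExp (∫⁻ x, f x ∂μ),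
    lintegral_negExp_poissonRandomMeasure _ hf]

lemma measurable_poissonProcess :
    Measurable (poissonProcess : LocFin X → Measure (PointMeas X)) := by
  refine measurable_of_measurable_laplace (j := fun μ : PointMeas X => μ.1)
    measurable_subtype_coe le_rfl fun f hf => ?_
  simp only [laplace_poissonProcess _ hf.measurable]
  exact measurable_negExp.comp (measurable_lintegral_locFin
    (measurable_const.sub (measurable_negExp.comp hf.measurable)))

lemma mecke_poissonProcess (κ : LocFin X) {g : X → ℝ≥0∞} (hg : Measurable g)
    {F : PointMeas X → ℝ≥0∞} (hF : Measurable F) :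
    ∫⁻ μ, (∫⁻ x, g x ∂(μ.1 : Measure X)) * F μ ∂(poissonProcess κ) =
      ∫⁻ x, g x * ∫⁻ μ, F (μ.addPoint x) ∂(poissonProcess κ) ∂(κ : Measure X) := by
  -- The Mecke formula is available for functionals of arbitrary measures, so `F` is extended by
  -- zero off the measurable set of point measures.
  let G : Measure X → ℝ≥0∞ := Function.extend (fun μ : PointMeas X => (μ.1 : Measure X)) F 0
  have hG : Measurable G :=
    measurableEmbedding_pointMeas_coe.measurable_extend hF measurable_zero
  have hGF : ∀ μ : PointMeas X, G μ.1 = F μ := fun μ =>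
    measurableEmbedding_pointMeas_coe.injective.extend_apply F 0 μ
  have h := mecke_poissonRandomMeasure (κ : Measure X) hg hG
  simp only [← lintegral_poissonProcess κ fun μ => (∫⁻ x, g x ∂μ) * G μ, hGF] at h
  rw [h]
  refine lintegral_congr fun x => ?_
  rw [← lintegral_poissonProcess κ fun μ => G (μ + Measure.dirac x)]
  congr 1
  exact lintegral_congr fun μ => hGF (μ.addPoint x)

end PoissonProcess

/-! ### The gamma Lévy measure: mean and Laplace exponent. -/

section GammaLevy

lemma lintegral_exp_neg_mul_Ioi {b : ℝ} (hb : 0 < b) :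
    ∫⁻ r in Set.Ioi 0, ENNReal.ofReal (Real.exp (-(b * r))) = ENNReal.ofReal b⁻¹ := by
  have hb' : -b < 0 := neg_lt_zero.2 hb
  simp only [← neg_mul]
  rw [← ofReal_integral_eq_lintegral_ofReal (integrableOn_exp_mul_Ioi hb' 0)
    (ae_of_all _ fun r => Real.exp_nonneg _), integral_exp_mul_Ioi hb' 0]
  simp

lemma lintegral_gammaLevy (z : ℝ) {F : ℝ → ℝ≥0∞} (hF : Measurable F) :
    ∫⁻ r, F r ∂(gammaLevy z) = ∫⁻ r in Set.Ioi 0,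
      ENNReal.ofReal (r⁻¹ * Real.exp (-((1 - z) / z) * r)) * F r := by
  rw [gammaLevy, lintegral_withDensity_eq_lintegral_mul _ (by fun_prop) hF]
  rfl

lemma lintegral_ofReal_gammaLevy {z : ℝ} (hz : z ∈ Set.Ioo (0 : ℝ) 1) :
    ∫⁻ r, ENNReal.ofReal r ∂(gammaLevy z) = ENNReal.ofReal (z / (1 - z)) := by
  have hc : 0 < (1 - z) / z := div_pos (by linarith [hz.2]) hz.1
  rw [lintegral_gammaLevy z ENNReal.measurable_ofReal, ← inv_div (1 - z) z, ← lintegral_exp_neg_mul_Ioi hc]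
  refine setLIntegral_congr_fun measurableSet_Ioi fun r hr => ?_
  have hr' : (0 : ℝ) < r := hr
  rw [← ENNReal.ofReal_mul (by positivity)]
  congr 1
  field_simp

lemma lintegral_exp_neg_mul_Ioc {r t : ℝ} (hr : 0 < r) (ht : 0 ≤ t) :
    ∫⁻ u in Set.Ioc 0 t, ENNReal.ofReal (Real.exp (-(r * u))) =
      ENNReal.ofReal (r⁻¹ * (1 - Real.exp (-(r * t)))) := by
  have hi : IntervalIntegrable (fun u => Real.exp (-(r * u))) volume 0 t :=
    (by fun_prop : Continuous fun u => Real.exp (-(r * u))).intervalIntegrable _ _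
  rw [← ofReal_integral_eq_lintegral_ofReal
    ((intervalIntegrable_iff_integrableOn_Ioc_of_le ht).1 hi)
    (ae_of_all _ fun u => Real.exp_nonneg _), ← intervalIntegral.integral_of_le ht]
  congr 1
  have hd : ∀ u ∈ Set.uIcc 0 t, HasDerivAt (fun u => -r⁻¹ * Real.exp (-(r * u)))
      (Real.exp (-(r * u))) u := fun u _ => by
    refine ((((hasDerivAt_id u).const_mul r).neg.exp).const_mul (-r⁻¹)).congr_deriv ?_
    simp only [id, Pi.neg_apply]
    field_simp
  rw [intervalIntegral.integral_eq_sub_of_hasDerivAt hd hi]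
  simp
  ring

lemma lintegral_inv_add_Ioc {c t : ℝ} (hc : 0 < c) (ht : 0 ≤ t) :
    ∫⁻ u in Set.Ioc 0 t, ENNReal.ofReal (u + c)⁻¹ = ENNReal.ofReal (Real.log (1 + t / c)) := by
  have hpos : ∀ u ∈ Set.uIcc 0 t, 0 < u + c := fun u hu => by
    rw [Set.uIcc_of_le ht] at hu
    linarith [hu.1]
  have hi : IntervalIntegrable (fun u => (u + c)⁻¹) volume 0 t :=
    ContinuousOn.intervalIntegrable (ContinuousOn.inv₀ (by fun_prop) fun u hu => (hpos u hu).ne')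
  rw [← ofReal_integral_eq_lintegral_ofReal
    ((intervalIntegrable_iff_integrableOn_Ioc_of_le ht).1 hi)
    (ae_restrict_of_forall_mem measurableSet_Ioc fun u hu => inv_nonneg.2 (by linarith [hu.1])),
    ← intervalIntegral.integral_of_le ht]
  congr 1
  have hd : ∀ u ∈ Set.uIcc 0 t, HasDerivAt (fun u => Real.log (u + c)) (u + c)⁻¹ u :=
    fun u hu => by
      simpa using ((hasDerivAt_id u).add_const c).log (hpos u hu).ne'
  rw [intervalIntegral.integral_eq_sub_of_hasDerivAt hd hi, zero_add,
    ← Real.log_div (by positivity) hc.ne']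
  congr 1
  field_simp
  ring

/-- Frullani's integral, the Laplace exponent of the gamma distribution. -/
lemma lintegral_one_sub_negExp_gammaLevy {z : ℝ} (hz : z ∈ Set.Ioo (0 : ℝ) 1) {s : ℝ≥0∞}
    (hs : s ≠ ∞) :
    ∫⁻ r, (1 - negExp (ENNReal.ofReal r * s)) ∂(gammaLevy z) =
      ENNReal.ofReal (Real.log (1 + s.toReal / ((1 - z) / z))) := by
  obtain ⟨t, ht, rfl⟩ : ∃ t : ℝ, 0 ≤ t ∧ s = ENNReal.ofReal t :=
    ⟨s.toReal, ENNReal.toReal_nonneg, (ENNReal.ofReal_toReal hs).symm⟩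
  set c := (1 - z) / z with hc_def
  have hc : 0 < c := div_pos (by linarith [hz.2]) hz.1
  have hm : Measurable fun r => 1 - negExp (ENNReal.ofReal r * ENNReal.ofReal t) :=
    measurable_const.sub (measurable_negExp.comp (ENNReal.measurable_ofReal.mul_const _))
  rw [ENNReal.toReal_ofReal ht, ← lintegral_inv_add_Ioc hc ht, lintegral_gammaLevy z hm]
  -- Writing `r⁻¹ (1 - e^{-rt})` as `∫_0^t e^{-ru} du` removes the singularity at `0`; Tonelli then
  -- leaves `∫_0^t (u + c)⁻¹ du`.
  have h1 : ∀ r ∈ Set.Ioi (0 : ℝ), ENNReal.ofReal (r⁻¹ * Real.exp (-c * r)) *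
      (1 - negExp (ENNReal.ofReal r * ENNReal.ofReal t)) =
      ∫⁻ u in Set.Ioc 0 t, ENNReal.ofReal (Real.exp (-((u + c) * r))) := by
    intro r hr
    have hr' : (0 : ℝ) < r := hr
    have hexp : ∀ u, ENNReal.ofReal (Real.exp (-((u + c) * r))) =
        ENNReal.ofReal (Real.exp (-c * r)) * ENNReal.ofReal (Real.exp (-(r * u))) := fun u => by
      rw [← ENNReal.ofReal_mul (Real.exp_nonneg _), ← Real.exp_add]
      congr 2
      ring
    simp only [hexp]
    rw [lintegral_const_mul _ (by fun_prop), lintegral_exp_neg_mul_Ioc hr' ht,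
      ← ENNReal.ofReal_mul hr'.le, negExp_ofReal (by positivity), ← ENNReal.ofReal_one,
      ← ENNReal.ofReal_sub _ (Real.exp_nonneg _), ← ENNReal.ofReal_mul (by positivity),
      ← ENNReal.ofReal_mul (by positivity)]
    congr 1
    ring
  rw [setLIntegral_congr_fun measurableSet_Ioi h1, lintegral_lintegral_swap
    (by fun_prop)]
  refine setLIntegral_congr_fun measurableSet_Ioc fun u hu => ?_
  exact lintegral_exp_neg_mul_Ioi (by linarith [hu.1])

end GammaLevy

/-! ### The Poisson-Gamma random measure: intensity and Laplace functional. -/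

section InfDiv

variable {X : Type*} [MetricSpace X] [MeasurableSpace X]

lemma measurable_bind_coe :
    Measurable fun N : Measure (LocFin X) => N.bind fun ν => (ν : Measure X) :=
  Measure.measurable_bind' measurable_subtype_coe

lemma lintegral_map_bind_coe (P : Measure (Measure (LocFin X))) {F : Measure X → ℝ≥0∞}
    (hF : Measurable F) : ∫⁻ κ, F κ ∂(P.map fun N => N.bind fun ν => (ν : Measure X)) =
      ∫⁻ N, F (N.bind fun ν => (ν : Measure X)) ∂P :=
  lintegral_map hF measurable_bind_coe

lemma lintegral_bind_coe (N : Measure (LocFin X)) {f : X → ℝ≥0∞} (hf : Measurable f) :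
    ∫⁻ x, f x ∂(N.bind fun ν => (ν : Measure X)) = ∫⁻ ν, ∫⁻ x, f x ∂(ν : Measure X) ∂N :=
  Measure.lintegral_bind measurable_subtype_coe.aemeasurable hf.aemeasurable

lemma lintegral_scaledDirac (x : X) (r : ℝ) {f : X → ℝ≥0∞} (hf : Measurable f) :
    ∫⁻ y, f y ∂(scaledDirac (x, r) : Measure X) = ENNReal.ofReal r * f x := by
  change ∫⁻ y, f y ∂(ENNReal.ofReal r • Measure.dirac x) = _
  rw [lintegral_smul_measure, lintegral_dirac' _ hf, smul_eq_mul]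

lemma lintegral_poissonGammaLevy (z : ℝ) (ρ : LocFin X) {G : ℝ≥0∞ → ℝ≥0∞} (hG : Measurable G)
    {f : X → ℝ≥0∞} (hf : Measurable f) :
    ∫⁻ ν, G (∫⁻ x, f x ∂(ν : Measure X)) ∂(poissonGammaLevy z ρ) =
      ∫⁻ x, ∫⁻ r, G (ENNReal.ofReal r * f x) ∂(gammaLevy z) ∂(ρ : Measure X) := by
  have hm : Measurable fun ν : LocFin X => G (∫⁻ x, f x ∂(ν : Measure X)) :=
    hG.comp (measurable_lintegral_locFin hf)
  have hms : Measurable fun p : X × ℝ => G (∫⁻ x, f x ∂(scaledDirac p : Measure X)) :=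
    hm.comp measurable_scaledDirac
  rw [poissonGammaLevy, lintegral_map hm measurable_scaledDirac,
    lintegral_prod _ hms.aemeasurable]
  simp only [lintegral_scaledDirac _ _ hf]

variable {z : ℝ}

lemma lintegral_lintegral_bind_poissonGammaLevy (hz : z ∈ Set.Ioo (0 : ℝ) 1) (ρ : LocFin X)
    {g : X → ℝ≥0∞} (hg : Measurable g) :
    ∫⁻ κ, ∫⁻ x, g x ∂κ ∂((poissonRandomMeasure (poissonGammaLevy z ρ)).map
      fun N => N.bind fun ν => (ν : Measure X)) =
      ENNReal.ofReal (z / (1 - z)) * ∫⁻ x, g x ∂(ρ : Measure X) := by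
  rw [lintegral_map_bind_coe _ (Measure.measurable_lintegral hg)]
  simp only [lintegral_bind_coe _ hg]
  rw [lintegral_lintegral_poissonRandomMeasure _ (measurable_lintegral_locFin hg),
    lintegral_poissonGammaLevy z ρ (G := fun y => y) measurable_id hg, ← lintegral_const_mul _ hg]
  refine lintegral_congr fun x => ?_
  rw [lintegral_mul_const _ ENNReal.measurable_ofReal, lintegral_ofReal_gammaLevy hz]

variable [BorelSpace X]

/-- The intensity `z / (1 - z) ρ` is finite on bounded sets, so the superposition is almost surely
locally finite and the restriction to `LocFin X` is harmless. -/
lemma lintegral_poissonGamma (hz : z ∈ Set.Ioo (0 : ℝ) 1) (ρ : LocFin X)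
    (F : Measure X → ℝ≥0∞) :
    ∫⁻ κ, F κ ∂(poissonGamma z ρ) = ∫⁻ κ, F κ ∂((poissonRandomMeasure (poissonGammaLevy z ρ)).map
      fun N => N.bind fun ν => (ν : Measure X)) := by
  refine lintegral_comap_locFin_coe (ae_locFin_of_lintegral_ne_top fun B hB hBm => ?_) F
  have h := lintegral_lintegral_bind_poissonGammaLevy hz ρ (g := B.indicator 1)
    (measurable_one.indicator hBm)
  simp only [lintegral_indicator_one hBm] at h
  rw [h]
  exact ENNReal.mul_ne_top ENNReal.ofReal_ne_top (ρ.2 B hB).ne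

lemma isProbabilityMeasure_poissonGamma (hz : z ∈ Set.Ioo (0 : ℝ) 1) (ρ : LocFin X) :
    IsProbabilityMeasure (poissonGamma z ρ) := by
  constructor
  rw [← lintegral_one, lintegral_poissonGamma hz ρ fun _ => 1,
    lintegral_map_bind_coe _ measurable_const, lintegral_one, measure_univ]

/-- The intensity measure of the Poisson-Gamma random measure. -/
lemma lintegral_lintegral_poissonGamma (hz : z ∈ Set.Ioo (0 : ℝ) 1) (ρ : LocFin X)
    {g : X → ℝ≥0∞} (hg : Measurable g) :
    ∫⁻ κ, ∫⁻ x, g x ∂(κ : Measure X) ∂(poissonGamma z ρ) =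
      ENNReal.ofReal (z / (1 - z)) * ∫⁻ x, g x ∂(ρ : Measure X) := by
  rw [lintegral_poissonGamma hz ρ fun κ => ∫⁻ x, g x ∂κ,
    lintegral_lintegral_bind_poissonGammaLevy hz ρ hg]

/-- The Laplace functional of the Poisson-Gamma random measure. -/
lemma laplace_poissonGamma (hz : z ∈ Set.Ioo (0 : ℝ) 1) (ρ : LocFin X)
    {f : X → ℝ≥0∞} (hf : Measurable f) (hf' : ∀ x, f x ≠ ∞) :
    ∫⁻ κ, negExp (∫⁻ x, f x ∂(κ : Measure X)) ∂(poissonGamma z ρ) =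
      negExp (∫⁻ x, ENNReal.ofReal (Real.log (1 + (f x).toReal / ((1 - z) / z)))
        ∂(ρ : Measure X)) := by
  have hm : Measurable fun κ : Measure X => negExp (∫⁻ x, f x ∂κ) :=
    measurable_negExp.comp (Measure.measurable_lintegral hf)
  rw [lintegral_poissonGamma hz ρ fun κ => negExp (∫⁻ x, f x ∂κ), lintegral_map_bind_coe _ hm]
  simp only [lintegral_bind_coe _ hf]
  rw [lintegral_negExp_poissonRandomMeasure _ (measurable_lintegral_locFin hf),
    lintegral_poissonGammaLevy z ρ (G := fun y => 1 - negExp y)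
      (measurable_const.sub measurable_negExp) hf]
  simp only [lintegral_one_sub_negExp_gammaLevy hz (hf' _)]

lemma measurable_poissonGamma (hz : z ∈ Set.Ioo (0 : ℝ) 1) :
    Measurable (poissonGamma z : LocFin X → Measure (LocFin X)) := by
  have := isProbabilityMeasure_poissonGamma (X := X) hz
  refine measurable_of_measurable_laplace (j := id) measurable_id MeasurableSpace.comap_id.ge
    fun f hf => ?_
  simp only [id, laplace_poissonGamma hz _ hf.measurable hf.ne_top]
  exact measurable_negExp.comp (measurable_lintegral_locFin (ENNReal.measurable_ofReal.comp
    (Real.measurable_log.comp ((hf.measurable.ennreal_toReal.div_const _).const_add _))))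

end InfDiv

/-! ### The scalar identity behind conjugacy. -/

section LaplaceExponent

/-- The Laplace exponent `s ↦ log (1 + s z / (1 - z))` of the gamma Lévy measure. -/
def gammaExponent (z : ℝ) (s : ℝ≥0∞) : ℝ≥0∞ :=
  ENNReal.ofReal (Real.log (1 + s.toReal / ((1 - z) / z)))

lemma measurable_gammaExponent (z : ℝ) : Measurable (gammaExponent z) :=
  ENNReal.measurable_ofReal.comp (Real.measurable_log.comp
    ((ENNReal.measurable_toReal.div_const _).const_add _))

lemma posterior_param_mem {z : ℝ} (hz : z ∈ Set.Ioo (0 : ℝ) 1) :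
    z / (1 + z) ∈ Set.Ioo (0 : ℝ) 1 := by
  have := hz.1
  exact ⟨by positivity, by rw [div_lt_one (by positivity)]; linarith⟩

/-- The posterior rate `z⁻¹ = (1 - z) / z + 1` is the prior rate raised by one, as in gamma-Poisson
conjugacy. -/
lemma one_sub_posterior_param {z : ℝ} (hz : z ∈ Set.Ioo (0 : ℝ) 1) :
    (1 - z / (1 + z)) / (z / (1 + z)) = z⁻¹ := by
  have := hz.1
  field_simp
  ring

/-- With `q = z / (1 - z)`, this is the logarithm of `1 + q (t + 1 - e^{-s}) = (1 + t z) (1 + q (1 -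
e^{-s} / (1 + t z)))`, which holds because `z (1 + q) = q`. -/
lemma gammaExponent_add_one_sub_negExp {z : ℝ} (hz : z ∈ Set.Ioo (0 : ℝ) 1) {s t : ℝ≥0∞}
    (hs : s ≠ ∞) (ht : t ≠ ∞) :
    gammaExponent z (t + (1 - negExp s)) = gammaExponent (z / (1 + z)) t +
      gammaExponent z (1 - negExp (s + gammaExponent (z / (1 + z)) t)) := by
  obtain ⟨a, ha, rfl⟩ : ∃ a : ℝ, 0 ≤ a ∧ s = ENNReal.ofReal a :=
    ⟨s.toReal, ENNReal.toReal_nonneg, (ENNReal.ofReal_toReal hs).symm⟩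
  obtain ⟨b, hb, rfl⟩ : ∃ b : ℝ, 0 ≤ b ∧ t = ENNReal.ofReal b :=
    ⟨t.toReal, ENNReal.toReal_nonneg, (ENNReal.ofReal_toReal ht).symm⟩
  have hz0 := hz.1
  have hz1 : 0 < 1 - z := by linarith [hz.2]
  have hbz : 0 ≤ b * z := by positivity
  have hlog : 0 ≤ Real.log (1 + b * z) := Real.log_nonneg (by linarith)
  have h1 : gammaExponent (z / (1 + z)) (ENNReal.ofReal b) =
      ENNReal.ofReal (Real.log (1 + b * z)) := by
    rw [gammaExponent, one_sub_posterior_param hz, ENNReal.toReal_ofReal hb, div_inv_eq_mul]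
  have hone : ∀ y, 0 ≤ y → 1 - negExp (ENNReal.ofReal y) = ENNReal.ofReal (1 - Real.exp (-y)) :=
    fun y hy => by
      rw [negExp_ofReal hy, ENNReal.ofReal_sub _ (Real.exp_nonneg _), ENNReal.ofReal_one]
  have hexp : ∀ y, 0 ≤ y → 0 ≤ 1 - Real.exp (-y) := fun y hy =>
    sub_nonneg.2 (Real.exp_le_one_iff.2 (by linarith))
  have hal : 0 ≤ a + Real.log (1 + b * z) := by positivity
  rw [h1, ← ENNReal.ofReal_add ha hlog, hone _ ha, hone _ hal, ← ENNReal.ofReal_add hb (hexp _ ha),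
    gammaExponent, gammaExponent, ENNReal.toReal_ofReal (hexp _ hal),
    ENNReal.toReal_ofReal (add_nonneg hb (hexp _ ha))]
  have h2 : 0 ≤ (1 - Real.exp (-(a + Real.log (1 + b * z)))) / ((1 - z) / z) :=
    div_nonneg (hexp _ hal) (by positivity)
  rw [← ENNReal.ofReal_add hlog (Real.log_nonneg (by linarith)),
    ← Real.log_mul (by positivity) (by positivity), neg_add, Real.exp_add, Real.exp_neg (Real.log _),
    Real.exp_log (by positivity)]
  congr 2
  field_simp
  ring

end LaplaceExponent

/-! ### The joint law of configuration and intensity, disintegrated both ways. -/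

section Posterior

variable {X : Type*} [MetricSpace X] [MeasurableSpace X]

lemma coe_locFin_add (μ ν : LocFin X) : ((μ + ν : LocFin X) : Measure X) = μ + ν := rfl

lemma measurable_locFin_add_pointMeas (ρ : LocFin X) :
    Measurable fun μ : PointMeas X => ρ + μ.1 :=
  Measurable.subtype_mk (measurable_measure_add.comp
    (measurable_const.prodMk measurable_pointMeas_coe))

lemma measurable_laplace_pointMeas {f : X → ℝ≥0∞} (hf : Measurable f) :
    Measurable fun μ : PointMeas X => negExp (∫⁻ x, f x ∂(μ.1 : Measure X)) :=
  measurable_negExp.comp ((measurable_lintegral_locFin hf).comp measurable_subtype_coe)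

variable [BorelSpace X]

/-- The kernel `μ ↦ GP_{z / (1 + z), ρ + μ}`. -/
def posteriorKernel {z : ℝ} (hz : z ∈ Set.Ioo (0 : ℝ) 1) (ρ : LocFin X) :
    Kernel (PointMeas X) (LocFin X) :=
  ⟨fun μ => poissonGamma (z / (1 + z)) (ρ + μ.1),
    (measurable_poissonGamma (posterior_param_mem hz)).comp (measurable_locFin_add_pointMeas ρ)⟩

lemma posteriorKernel_apply {z : ℝ} (hz : z ∈ Set.Ioo (0 : ℝ) 1) (ρ : LocFin X) (μ : PointMeas X) :
    posteriorKernel hz ρ μ = poissonGamma (z / (1 + z)) (ρ + μ.1) := rfl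

instance {z : ℝ} (hz : z ∈ Set.Ioo (0 : ℝ) 1) (ρ : LocFin X) :
    IsMarkovKernel (posteriorKernel hz ρ) :=
  ⟨fun μ => isProbabilityMeasure_poissonGamma (posterior_param_mem hz) (ρ + μ.1)⟩

variable [SecondCountableTopology X]

/-- The Poisson process as a kernel. -/
def poissonKernel : Kernel (LocFin X) (PointMeas X) := ⟨poissonProcess, measurable_poissonProcess⟩

instance : IsMarkovKernel (poissonKernel (X := X)) := ⟨isProbabilityMeasure_poissonProcess⟩

lemma lintegral_coxProcess (Q : Measure (LocFin X)) {F : PointMeas X → ℝ≥0∞} (hF : Measurable F) :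
    ∫⁻ μ, F μ ∂(coxProcess Q) = ∫⁻ κ, ∫⁻ μ, F μ ∂(poissonProcess κ) ∂Q :=
  Measure.lintegral_bind measurable_poissonProcess.aemeasurable hF.aemeasurable

instance (Q : Measure (LocFin X)) [IsProbabilityMeasure Q] :
    IsProbabilityMeasure (coxProcess Q) := by
  constructor
  rw [← lintegral_one, lintegral_coxProcess Q measurable_const]
  simp

lemma laplace_coxProcess_poissonGamma {z : ℝ} (hz : z ∈ Set.Ioo (0 : ℝ) 1) (ρ : LocFin X)
    {f : X → ℝ≥0∞} (hf : Measurable f) :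
    ∫⁻ μ, negExp (∫⁻ x, f x ∂(μ.1 : Measure X)) ∂(coxProcess (poissonGamma z ρ)) =
      negExp (∫⁻ x, gammaExponent z (1 - negExp (f x)) ∂(ρ : Measure X)) := by
  rw [lintegral_coxProcess _ (measurable_laplace_pointMeas hf)]
  simp only [laplace_poissonProcess _ hf]
  exact laplace_poissonGamma hz ρ (measurable_const.sub (measurable_negExp.comp hf))
    fun x => ENNReal.sub_ne_top ENNReal.one_ne_top

lemma lintegral_swap_compProd (Q : Measure (LocFin X)) [SFinite Q]
    {f : PointMeas X × LocFin X → ℝ≥0∞} (hf : Measurable f) :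
    ∫⁻ p, f p ∂((Q ⊗ₘ poissonKernel).map Prod.swap) =
      ∫⁻ κ, ∫⁻ μ, f (μ, κ) ∂(poissonProcess κ) ∂Q := by
  have hfs : Measurable fun p : LocFin X × PointMeas X => f p.swap := hf.comp measurable_swap
  rw [lintegral_map hf measurable_swap, Measure.lintegral_compProd hfs]
  rfl

/-- Turns Bayes' formula into an equality of two joint laws, which Laplace functionals can decide
and from which the kernel can be recovered almost everywhere. -/
lemma isBayesKernel_iff (Q : Measure (LocFin X)) [IsProbabilityMeasure Q]
    (P : Measure (PointMeas X)) [SFinite P] (B : Kernel (PointMeas X) (LocFin X))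
    [IsMarkovKernel B] :
    IsBayesKernel Q P B ↔ (Q ⊗ₘ poissonKernel).map Prod.swap = P ⊗ₘ B := by
  constructor
  · intro h
    refine Measure.ext_of_lintegral _ fun f hf => ?_
    rw [lintegral_swap_compProd Q hf, Measure.lintegral_compProd hf]
    exact h.disintegration (fun μ κ => f (μ, κ)) hf
  · intro h
    refine ⟨inferInstance, fun f hf => ?_⟩
    have h1 := lintegral_swap_compProd Q hf
    rw [h, Measure.lintegral_compProd hf] at h1
    exact h1.symm

theorem swap_compProd_eq_coxProcess_compProd {z : ℝ} (hz : z ∈ Set.Ioo (0 : ℝ) 1) (ρ : LocFin X) :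
    (poissonGamma z ρ ⊗ₘ poissonKernel).map Prod.swap =
      coxProcess (poissonGamma z ρ) ⊗ₘ posteriorKernel hz ρ := by
  have hP := isProbabilityMeasure_poissonGamma hz ρ
  have : IsProbabilityMeasure ((poissonGamma z ρ ⊗ₘ poissonKernel).map Prod.swap) :=
    Measure.isProbabilityMeasure_map measurable_swap.aemeasurable
  have hj₁ : Measurable fun p : PointMeas X × LocFin X => p.1.1 :=
    measurable_subtype_coe.comp measurable_fst
  refine ext_of_laplace_pair hj₁ measurable_snd (le_of_eq ?_) fun f g hf hg => ?_
  · change MeasurableSpace.comap Prod.fst (MeasurableSpace.comap Subtype.val _) ⊔ _ = _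
    rw [MeasurableSpace.comap_comp]
    rfl
  have hLf := measurable_laplace_pointMeas hf.measurable
  have hLg : Measurable fun κ : LocFin X => negExp (∫⁻ x, g x ∂(κ : Measure X)) :=
    measurable_negExp.comp (measurable_lintegral_locFin hg.measurable)
  have hm : Measurable fun p : PointMeas X × LocFin X =>
      negExp (∫⁻ x, f x ∂(p.1.1 : Measure X)) * negExp (∫⁻ x, g x ∂(p.2 : Measure X)) :=
    (hLf.comp measurable_fst).mul (hLg.comp measurable_snd)
  have hEg : Measurable fun x => gammaExponent (z / (1 + z)) (g x) :=
    (measurable_gammaExponent _).comp hg.measurable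
  have hnf : Measurable fun x => 1 - negExp (f x) :=
    measurable_const.sub (measurable_negExp.comp hf.measurable)
  rw [lintegral_swap_compProd _ hm, Measure.lintegral_compProd hm]
  simp only [lintegral_mul_const _ hLf, lintegral_const_mul _ hLg, posteriorKernel_apply,
    laplace_poissonProcess _ hf.measurable, laplace_poissonGamma (posterior_param_mem hz) _
    hg.measurable hg.ne_top]
  have hfE : Measurable fun x => f x + gammaExponent (z / (1 + z)) (g x) := hf.measurable.add hEg
  have hgf : Measurable fun x => g x + (1 - negExp (f x)) := hg.measurable.add hnf
  have h1 : ∀ κ : LocFin X, negExp (∫⁻ x, (1 - negExp (f x)) ∂(κ : Measure X)) *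
      negExp (∫⁻ x, g x ∂(κ : Measure X)) =
      negExp (∫⁻ x, (g x + (1 - negExp (f x))) ∂(κ : Measure X)) := fun κ => by
    rw [lintegral_add_left hg.measurable, negExp_add, mul_comm]
  -- The posterior transform is exponential in `ρ + μ`: the `ρ` part leaves the integral, and the
  -- `μ` part merges with `f` into one transform of the mixture.
  have h2 : ∀ μ : PointMeas X, negExp (∫⁻ x, f x ∂(μ.1 : Measure X)) *
      negExp (∫⁻ x, gammaExponent (z / (1 + z)) (g x) ∂((ρ + μ.1 : LocFin X) : Measure X)) =
      negExp (∫⁻ x, gammaExponent (z / (1 + z)) (g x) ∂(ρ : Measure X)) *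
      negExp (∫⁻ x, (f x + gammaExponent (z / (1 + z)) (g x)) ∂(μ.1 : Measure X)) := fun μ => by
    rw [coe_locFin_add, lintegral_add_measure, lintegral_add_left hf.measurable, negExp_add,
      negExp_add]
    ring
  change _ = ∫⁻ μ, negExp (∫⁻ x, f x ∂(μ.1 : Measure X)) *
      negExp (∫⁻ x, gammaExponent (z / (1 + z)) (g x) ∂((ρ + μ.1 : LocFin X) : Measure X))
      ∂(coxProcess (poissonGamma z ρ))
  rw [lintegral_congr h1, lintegral_congr h2,
    lintegral_const_mul _ (measurable_laplace_pointMeas hfE),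
    laplace_coxProcess_poissonGamma hz ρ hfE, laplace_poissonGamma hz ρ hgf (fun x => ENNReal.add_ne_top.2
      ⟨hg.ne_top x, ENNReal.sub_ne_top ENNReal.one_ne_top⟩), ← negExp_add,
    ← lintegral_add_left hEg]
  congr 1
  exact lintegral_congr fun x => gammaExponent_add_one_sub_negExp hz (hf.ne_top x) (hg.ne_top x)

theorem isBayesKernel_posteriorKernel {z : ℝ} (hz : z ∈ Set.Ioo (0 : ℝ) 1) (ρ : LocFin X) :
    IsBayesKernel (poissonGamma z ρ) (coxProcess (poissonGamma z ρ)) (posteriorKernel hz ρ) := by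
  have := isProbabilityMeasure_poissonGamma hz ρ
  rw [isBayesKernel_iff]
  exact swap_compProd_eq_coxProcess_compProd hz ρ

theorem IsBayesKernel.ae_eq {Q : Measure (LocFin X)} [IsProbabilityMeasure Q]
    {P : Measure (PointMeas X)} [IsProbabilityMeasure P] {B B' : Kernel (PointMeas X) (LocFin X)}
    (h : IsBayesKernel Q P B) (h' : IsBayesKernel Q P B') : B =ᵐ[P] B' := by
  have := h.isMarkovKernel
  have := h'.isMarkovKernel
  exact Kernel.ae_eq_of_compProd_eq
    (((isBayesKernel_iff Q P B).1 h).symm.trans ((isBayesKernel_iff Q P B').1 h'))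

end Posterior

/-! ### The tautological kernel of locally finite measures is s-finite. -/

section SFiniteKernel

variable {α β : Type*} [MeasurableSpace α] [MeasurableSpace β]

/-- The masses need not be uniformly bounded, so the parameter space is cut according to the integer
part of the mass. -/
lemma isSFiniteKernel_of_measure_univ_ne_top (η : Kernel α β) (h : ∀ a, η a Set.univ ≠ ∞) :
    IsSFiniteKernel η := by
  classical
  let N : α → ℕ := fun a => ⌊(η a Set.univ).toReal⌋₊
  have hN : Measurable N := (η.measurable_coe MeasurableSet.univ).ennreal_toReal.nat_floor
  have hs : ∀ j, MeasurableSet {a | N a = j} := fun j => hN (measurableSet_singleton j)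
  let K : ℕ → Kernel α β := fun j => Kernel.piecewise (hs j) η 0
  have hK : ∀ j, IsFiniteKernel (K j) := fun j => by
    refine ⟨(j : ℝ≥0∞) + 1, by finiteness, fun a => ?_⟩
    simp only [K, Kernel.piecewise_apply]
    split_ifs with ha
    · have hlt := Nat.lt_floor_add_one (η a Set.univ).toReal
      rw [show ⌊(η a Set.univ).toReal⌋₊ = j from ha] at hlt
      rw [← ENNReal.ofReal_toReal (h a), ← ENNReal.ofReal_natCast, ← ENNReal.ofReal_one,
        ← ENNReal.ofReal_add (by positivity) zero_le_one]
      exact ENNReal.ofReal_le_ofReal hlt.le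
    · simp
  refine ⟨K, hK, ?_⟩
  ext a s hs'
  rw [Kernel.sum_apply' _ _ hs', tsum_eq_single (N a)]
  · simp [K, Kernel.piecewise_apply]
  · intro j hj
    simp [K, Kernel.piecewise_apply, hj.symm]

variable {X : Type*} [MetricSpace X] [MeasurableSpace X]

/-- The tautological kernel `κ ↦ κ`. -/
def locFinKernel : Kernel (LocFin X) X := ⟨fun κ => κ, measurable_subtype_coe⟩

instance [BorelSpace X] : IsSFiniteKernel (locFinKernel (X := X)) := by
  rcases isEmpty_or_nonempty X with hX | ⟨⟨x⟩⟩
  · exact isSFiniteKernel_of_measure_univ_ne_top _ fun κ => by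
      rw [Measure.eq_zero_of_isEmpty (locFinKernel κ)]
      simp
  let D : ℕ → Set X := disjointed fun n : ℕ => Metric.ball x n
  have hD : ∀ n, MeasurableSet (D n) := fun n =>
    MeasurableSet.disjointed (fun n => Metric.isOpen_ball.measurableSet) n
  have hfin : ∀ n, IsSFiniteKernel (Kernel.restrict (locFinKernel (X := X)) (hD n)) := fun n => by
    refine isSFiniteKernel_of_measure_univ_ne_top _ fun κ => ?_
    rw [Kernel.restrict_apply, Measure.restrict_apply_univ]
    exact (κ.2 _ (Metric.isBounded_ball.subset (disjointed_subset _ n))).ne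
  have hsum : locFinKernel (X := X) = Kernel.sum fun n => Kernel.restrict locFinKernel (hD n) := by
    ext1 κ
    rw [Kernel.sum_apply]
    simp only [Kernel.restrict_apply]
    rw [← Measure.restrict_iUnion (disjoint_disjointed _) hD, iUnion_disjointed,
      Metric.iUnion_ball_nat, Measure.restrict_univ]
  rw [hsum]
  infer_instance

end SFiniteKernel

/-! ### The mixture solves the Pólya sum equation. -/

section Campbell

variable {X : Type*} [MetricSpace X] [MeasurableSpace X]

lemma measurable_lintegral_locFin_prod [BorelSpace X] {T : Type*} [MeasurableSpace T]
    {j : T → LocFin X} (hj : Measurable j) {f : T → X → ℝ≥0∞}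
    (hf : Measurable (Function.uncurry f)) :
    Measurable fun t => ∫⁻ x, f t x ∂(j t : Measure X) :=
  Measurable.lintegral_kernel_prod_right (κ := locFinKernel.comap j hj) hf

variable [BorelSpace X]

lemma measurable_addPoint :
    Measurable fun p : PointMeas X × X => p.1.addPoint p.2 :=
  ((measurable_add_dirac.comp
    ((measurable_pointMeas_coe.comp measurable_fst).prodMk measurable_snd)).subtype_mk).subtype_mk

/-- To verify the integral equation of the Pólya sum process it suffices to consider indicators of
measurable rectangles. -/
lemma campbell_of_indicator (z : ℝ) (ρ : LocFin X) (P : Measure (PointMeas X))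
    [IsProbabilityMeasure P]
    (H : ∀ (B : Set X) (A : Set (PointMeas X)), MeasurableSet B → MeasurableSet A →
      ∫⁻ μ, (∫⁻ x, B.indicator 1 x ∂(μ.1 : Measure X)) * A.indicator 1 μ ∂P =
        ENNReal.ofReal z * ∫⁻ μ, ∫⁻ x, B.indicator 1 x * A.indicator 1 (μ.addPoint x)
          ∂((ρ + μ.1 : LocFin X) : Measure X) ∂P)
    {h : X → PointMeas X → ℝ≥0∞} (hh : Measurable (Function.uncurry h)) :
    ∫⁻ μ, ∫⁻ x, h x μ ∂(μ.1 : Measure X) ∂P =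
      ENNReal.ofReal z *
        ∫⁻ μ, ∫⁻ x, h x (μ.addPoint x) ∂((ρ + μ.1 : LocFin X) : Measure X) ∂P := by
  rcases isEmpty_or_nonempty X with hX | ⟨⟨x₀⟩⟩
  · simp
  let K₁ : Kernel (PointMeas X) X :=
    locFinKernel.comap (fun μ : PointMeas X => μ.1) measurable_subtype_coe
  let K₂ : Kernel (PointMeas X) X :=
    locFinKernel.comap (fun μ : PointMeas X => ρ + μ.1) (measurable_locFin_add_pointMeas ρ)
  have hT : Measurable fun p : PointMeas X × X => (p.2, p.1.addPoint p.2) :=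
    measurable_snd.prodMk measurable_addPoint
  let C : Measure (X × PointMeas X) := (P ⊗ₘ K₁).map Prod.swap
  let D : Measure (X × PointMeas X) :=
    ENNReal.ofReal z • (P ⊗ₘ K₂).map fun p => (p.2, p.1.addPoint p.2)
  have hC : ∀ f : X × PointMeas X → ℝ≥0∞, Measurable f →
      ∫⁻ p, f p ∂C = ∫⁻ μ, ∫⁻ x, f (x, μ) ∂(μ.1 : Measure X) ∂P := fun f hf => by
    have hfs : Measurable fun p : PointMeas X × X => f p.swap := hf.comp measurable_swap
    rw [lintegral_map hf measurable_swap, Measure.lintegral_compProd hfs]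
    rfl
  have hD : ∀ f : X × PointMeas X → ℝ≥0∞, Measurable f →
      ∫⁻ p, f p ∂D = ENNReal.ofReal z * ∫⁻ μ, ∫⁻ x, f (x, μ.addPoint x)
        ∂((ρ + μ.1 : LocFin X) : Measure X) ∂P := fun f hf => by
    have hfT : Measurable fun p : PointMeas X × X => f (p.2, p.1.addPoint p.2) := hf.comp hT
    rw [lintegral_smul_measure, lintegral_map hf hT, Measure.lintegral_compProd hfT]
    rfl
  have hrect : ∀ (B : Set X) (A : Set (PointMeas X)) (p : X × PointMeas X),
      (B ×ˢ A).indicator (1 : X × PointMeas X → ℝ≥0∞) p =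
        B.indicator 1 p.1 * A.indicator 1 p.2 := fun B A p => by
    by_cases h1 : p.1 ∈ B <;> by_cases h2 : p.2 ∈ A <;> simp [h1, h2]
  have hCrect : ∀ (B : Set X) (A : Set (PointMeas X)), MeasurableSet B → MeasurableSet A →
      C (B ×ˢ A) = ∫⁻ μ, (∫⁻ x, B.indicator 1 x ∂(μ.1 : Measure X)) * A.indicator 1 μ ∂P :=
    fun B A hB hA => by
      rw [← lintegral_indicator_one (hB.prod hA), hC _ (measurable_one.indicator (hB.prod hA))]
      simp only [hrect]
      exact lintegral_congr fun μ => lintegral_mul_const _ (measurable_one.indicator hB)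
  have hDrect : ∀ (B : Set X) (A : Set (PointMeas X)), MeasurableSet B → MeasurableSet A →
      D (B ×ˢ A) = ENNReal.ofReal z * ∫⁻ μ, ∫⁻ x, B.indicator 1 x * A.indicator 1 (μ.addPoint x)
          ∂((ρ + μ.1 : LocFin X) : Measure X) ∂P := fun B A hB hA => by
    rw [← lintegral_indicator_one (hB.prod hA), hD _ (measurable_one.indicator (hB.prod hA))]
    simp only [hrect]
  -- `P` may have infinite intensity on a ball, so the exhausting rectangles also bound the number
  -- of points there, which makes `C` finite on them.
  let S : ℕ × ℕ → Set (X × PointMeas X) := fun q =>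
    Metric.ball x₀ q.1 ×ˢ {μ : PointMeas X | (μ.1 : Measure X) (Metric.ball x₀ q.1) ≤ q.2}
  have hSm : ∀ k m : ℕ, MeasurableSet
      {μ : PointMeas X | (μ.1 : Measure X) (Metric.ball x₀ k) ≤ m} := fun k m =>
    measurableSet_le ((Measure.measurable_coe Metric.isOpen_ball.measurableSet).comp
      measurable_pointMeas_coe) measurable_const
  have hCD : C = D := by
    refine Measure.ext_of_generateFrom_of_iUnion _ (fun n => S n.unpair) generateFrom_prod.symm
      isPiSystem_prod ?_ ?_ ?_ ?_
    · refine Set.eq_univ_of_forall fun p => Set.mem_iUnion.2 ?_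
      obtain ⟨k, hk⟩ := exists_nat_gt (dist p.1 x₀)
      obtain ⟨m, hm⟩ := ENNReal.exists_nat_gt
        (p.2.1.2 (Metric.ball x₀ k) Metric.isBounded_ball).ne
      refine ⟨Nat.pair k m, ?_⟩
      rw [Nat.unpair_pair]
      exact ⟨hk, hm.le⟩
    · exact fun n => ⟨_, Metric.isOpen_ball.measurableSet, _, hSm _ _, rfl⟩
    · intro n
      rw [hCrect _ _ Metric.isOpen_ball.measurableSet (hSm _ _)]
      refine ne_top_of_le_ne_top (b := ∫⁻ _, ((n.unpair.2 : ℕ) : ℝ≥0∞) ∂P) (by simp)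
        (lintegral_mono fun μ => ?_)
      rw [lintegral_indicator_one Metric.isOpen_ball.measurableSet]
      by_cases hμ : (μ.1 : Measure X) (Metric.ball x₀ n.unpair.1) ≤ n.unpair.2
      · rw [Set.indicator_of_mem (by exact hμ)]
        simpa using hμ
      · rw [Set.indicator_of_notMem (by exact hμ)]
        simp
    · rintro _ ⟨B, hB, A, hA, rfl⟩
      rw [hCrect B A hB hA, hDrect B A hB hA, H B A hB hA]
  have h1 := hC _ hh
  rw [hCD, hD _ hh] at h1
  exact h1.symm

variable [SecondCountableTopology X]

/-- The Campbell formula of the Pólya sum process for products of functions of the point and of the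
configuration. -/
lemma lintegral_mul_coxProcess_poissonGamma {z : ℝ} (hz : z ∈ Set.Ioo (0 : ℝ) 1) (ρ : LocFin X)
    {g : X → ℝ≥0∞} (hg : Measurable g) {F : PointMeas X → ℝ≥0∞} (hF : Measurable F) :
    ∫⁻ μ, (∫⁻ x, g x ∂(μ.1 : Measure X)) * F μ ∂(coxProcess (poissonGamma z ρ)) =
      ENNReal.ofReal z * ∫⁻ μ, ∫⁻ x, g x * F (μ.addPoint x) ∂((ρ + μ.1 : LocFin X) : Measure X)
        ∂(coxProcess (poissonGamma z ρ)) := by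
  have hgF : Measurable fun μ : PointMeas X => (∫⁻ x, g x ∂(μ.1 : Measure X)) * F μ :=
    ((measurable_lintegral_locFin hg).comp measurable_subtype_coe).mul hF
  have hFa : ∀ μ : PointMeas X, Measurable fun x => g x * F (μ.addPoint x) := fun μ =>
    hg.mul (hF.comp (measurable_addPoint.comp measurable_prodMk_left))
  have hFb : ∀ x, Measurable fun μ : PointMeas X => F (μ.addPoint x) := fun x =>
    hF.comp (measurable_addPoint.comp measurable_prodMk_right)
  have hgFm : Measurable fun p : X × PointMeas X => g p.1 * F (p.2.addPoint p.1) :=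
    (hg.comp measurable_fst).mul (hF.comp (measurable_addPoint.comp measurable_swap))
  have hH : Measurable (Function.uncurry fun (μ : PointMeas X) (κ : LocFin X) =>
      ∫⁻ x, g x * F (μ.addPoint x) ∂(κ : Measure X)) := by
    refine measurable_lintegral_locFin_prod (T := PointMeas X × LocFin X)
      (f := fun p x => g x * F (p.1.addPoint x)) measurable_snd ?_
    exact hgFm.comp (measurable_snd.prodMk (measurable_fst.comp measurable_fst))
  have hz' := posterior_param_mem hz
  have hzz : z / (1 + z) / (1 - z / (1 + z)) = z := by
    have := one_sub_posterior_param hz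
    rw [← inv_div, this, inv_inv]
  rw [lintegral_coxProcess _ hgF]
  -- Mecke's formula given `κ`. The result is linear in `κ`, so after the exchange of conditioning
  -- below only the posterior mean of `κ` enters.
  have h1 : ∀ κ : LocFin X,
      ∫⁻ μ, (∫⁻ x, g x ∂(μ.1 : Measure X)) * F μ ∂(poissonProcess κ) =
      ∫⁻ μ, ∫⁻ x, g x * F (μ.addPoint x) ∂(κ : Measure X) ∂(poissonProcess κ) := fun κ => by
    rw [mecke_poissonProcess κ hg hF, ← lintegral_lintegral_swap hgFm.aemeasurable]
    exact lintegral_congr fun x => (lintegral_const_mul _ (hFb x)).symm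
  rw [lintegral_congr h1, (isBayesKernel_posteriorKernel hz ρ).disintegration _ hH,
    ← lintegral_const_mul]
  · refine lintegral_congr fun μ => ?_
    rw [posteriorKernel_apply, lintegral_lintegral_poissonGamma hz' _ (hFa μ), hzz]
  · exact measurable_lintegral_locFin_prod (measurable_locFin_add_pointMeas ρ)
      (hgFm.comp measurable_swap)

theorem isPolyaSumProcess_coxProcess {z : ℝ} (hz : z ∈ Set.Ioo (0 : ℝ) 1) (ρ : LocFin X) :
    IsPolyaSumProcess z ρ (coxProcess (poissonGamma z ρ)) := by
  have := isProbabilityMeasure_poissonGamma hz ρ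
  exact ⟨inferInstance, fun h hh => campbell_of_indicator z ρ _ (fun B A hB hA =>
    lintegral_mul_coxProcess_poissonGamma hz ρ (measurable_one.indicator hB)
      (measurable_one.indicator hA)) hh⟩

end Campbell

/-! ### Uniqueness through a differential equation for Laplace transforms. -/

section Uniqueness

/-- From `t y ≤ e^{t y}`. It replaces a moment assumption on the Pólya sum process. -/
lemma mul_negExp_const_mul_le {t : ℝ} (ht : 0 < t) {y : ℝ≥0∞} (hy : y ≠ ∞) :
    y * negExp (ENNReal.ofReal t * y) ≤ ENNReal.ofReal t⁻¹ := by
  obtain ⟨a, ha, rfl⟩ : ∃ a : ℝ, 0 ≤ a ∧ y = ENNReal.ofReal a :=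
    ⟨y.toReal, ENNReal.toReal_nonneg, (ENNReal.ofReal_toReal hy).symm⟩
  rw [← ENNReal.ofReal_mul ht.le, negExp_ofReal (by positivity), ← ENNReal.ofReal_mul ha]
  refine ENNReal.ofReal_le_ofReal ?_
  rw [Real.exp_neg, mul_inv_le_iff₀ (Real.exp_pos _), ← div_eq_inv_mul, le_div_iff₀ ht]
  linarith [Real.add_one_le_exp (t * a)]

variable {X : Type*} [MetricSpace X] [MeasurableSpace X] [BorelSpace X]

/-- The logarithmic derivative of the Laplace transform of `∫ f dμ` under a Pólya sum process is
determined by the parameters. -/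
lemma IsPolyaSumProcess.lintegral_mul_negExp {z : ℝ} (hz : z ∈ Set.Ioo (0 : ℝ) 1) {ρ : LocFin X}
    {P : Measure (PointMeas X)} (hP : IsPolyaSumProcess z ρ P) {f : X → ℝ≥0∞} (hf : IsTest f)
    {t : ℝ} (ht : 0 < t) :
    ∫⁻ μ, (∫⁻ x, f x ∂(μ.1 : Measure X)) *
        negExp (ENNReal.ofReal t * ∫⁻ x, f x ∂(μ.1 : Measure X)) ∂P =
      (ENNReal.ofReal z * ∫⁻ x, f x / (1 - ENNReal.ofReal z * negExp (ENNReal.ofReal t * f x)) *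
        negExp (ENNReal.ofReal t * f x) ∂(ρ : Measure X)) *
      ∫⁻ μ, negExp (ENNReal.ofReal t * ∫⁻ x, f x ∂(μ.1 : Measure X)) ∂P := by
  have := hP.isProbabilityMeasure
  set c := ENNReal.ofReal z
  have hc1 : c < 1 := by
    rw [← ENNReal.ofReal_one]
    exact (ENNReal.ofReal_lt_ofReal_iff one_pos).2 hz.2
  set e : X → ℝ≥0∞ := fun x => negExp (ENNReal.ofReal t * f x)
  -- Chosen to solve `g = f + c g e`: in the integral equation for `g L`, the terms with `c g e`
  -- integrated against `μ` then cancel and only `μ(f)` remains.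
  set g : X → ℝ≥0∞ := fun x => f x / (1 - c * e x)
  set L : PointMeas X → ℝ≥0∞ := fun μ => negExp (ENNReal.ofReal t * ∫⁻ x, f x ∂(μ.1 : Measure X))
  have he : Measurable e := measurable_negExp.comp (hf.measurable.const_mul _)
  have hg : Measurable g := hf.measurable.div (measurable_const.sub (he.const_mul c))
  have hge : Measurable fun x => g x * e x := hg.mul he
  have hfi : Measurable fun μ : PointMeas X => ∫⁻ x, f x ∂(μ.1 : Measure X) :=
    (measurable_lintegral_locFin hf.measurable).comp measurable_subtype_coe
  have hgei : Measurable fun μ : PointMeas X => ∫⁻ x, g x * e x ∂(μ.1 : Measure X) :=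
    (measurable_lintegral_locFin hge).comp measurable_subtype_coe
  have hL : Measurable L := measurable_negExp.comp (hfi.const_mul _)
  have hce : ∀ x, c * e x ≤ c := fun x => (mul_le_mul' le_rfl (negExp_le_one _)).trans_eq (mul_one c)
  have hdec : ∀ x, g x = f x + c * (g x * e x) := fun x => by
    have hlt : c * e x < 1 := (hce x).trans_lt hc1
    calc g x = g x * ((1 - c * e x) + c * e x) := by rw [tsub_add_cancel_of_le hlt.le, mul_one]
      _ = g x * (1 - c * e x) + g x * (c * e x) := mul_add _ _ _
      _ = f x + c * (g x * e x) := by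
        rw [ENNReal.div_mul_cancel (tsub_pos_of_lt hlt).ne'
          (ENNReal.sub_ne_top ENNReal.one_ne_top), mul_left_comm]
  have hgle : ∀ x, c * (g x * e x) ≤ (1 - c)⁻¹ * f x := fun x => by
    calc c * (g x * e x) ≤ g x := le_add_self.trans_eq (hdec x).symm
      _ ≤ f x / (1 - c) := ENNReal.div_le_div_left (tsub_le_tsub_left (hce x) 1) _
      _ = (1 - c)⁻¹ * f x := by rw [div_eq_mul_inv, mul_comm]
  have hLadd : ∀ (μ : PointMeas X) x, L (μ.addPoint x) = e x * L μ := fun μ x => by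
    change negExp (ENNReal.ofReal t * ∫⁻ y, f y ∂((μ.1 : Measure X) + Measure.dirac x)) = _
    rw [lintegral_add_measure, lintegral_dirac' _ hf.measurable, mul_add, negExp_add, mul_comm]
  have h1 := hP.campbell (fun x μ => g x * L μ)
    ((hg.comp measurable_fst).mul (hL.comp measurable_snd))
  simp only [hLadd, ← mul_assoc] at h1
  have h2 : ∀ μ : PointMeas X, ∫⁻ x, g x * L μ ∂(μ.1 : Measure X) =
      (∫⁻ x, f x ∂(μ.1 : Measure X)) * L μ +
        c * ((∫⁻ x, g x * e x ∂(μ.1 : Measure X)) * L μ) := fun μ => by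
    rw [lintegral_mul_const _ hg, lintegral_congr hdec, lintegral_add_left hf.measurable,
      lintegral_const_mul _ hge, add_mul, mul_assoc]
  have h3 : ∀ μ : PointMeas X, ∫⁻ x, g x * e x * L μ ∂((ρ + μ.1 : LocFin X) : Measure X) =
      (∫⁻ x, g x * e x ∂(ρ : Measure X)) * L μ +
        (∫⁻ x, g x * e x ∂(μ.1 : Measure X)) * L μ := fun μ => by
    rw [lintegral_mul_const _ hge, coe_locFin_add, lintegral_add_measure, add_mul]
  have hfL : Measurable fun μ : PointMeas X => (∫⁻ x, f x ∂(μ.1 : Measure X)) * L μ := hfi.mul hL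
  have hgeL : Measurable fun μ : PointMeas X => (∫⁻ x, g x * e x ∂(μ.1 : Measure X)) * L μ :=
    hgei.mul hL
  rw [lintegral_congr h2, lintegral_congr h3, lintegral_add_left hfL,
    lintegral_add_left (hL.const_mul _), lintegral_const_mul _ hL,
    lintegral_const_mul _ hgeL, mul_add] at h1
  -- Cancelling in `[0, ∞]` requires a finite term; `c g e ≤ f / (1 - c)` and the damping factor `L`
  -- with `t > 0` provide it.
  have hfin : c * ∫⁻ μ, (∫⁻ x, g x * e x ∂(μ.1 : Measure X)) * L μ ∂P ≠ ∞ := by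
    rw [← lintegral_const_mul _ hgeL]
    refine ne_top_of_le_ne_top (b := ∫⁻ _, (1 - c)⁻¹ * ENNReal.ofReal t⁻¹ ∂P) ?_
      (lintegral_mono fun μ => ?_)
    · rw [lintegral_const, measure_univ, mul_one]
      exact ENNReal.mul_ne_top (ENNReal.inv_ne_top.2 (tsub_pos_of_lt hc1).ne')
        ENNReal.ofReal_ne_top
    · rw [← mul_assoc, ← lintegral_const_mul _ hge]
      calc (∫⁻ x, c * (g x * e x) ∂(μ.1 : Measure X)) * L μ
          ≤ ((1 - c)⁻¹ * ∫⁻ x, f x ∂(μ.1 : Measure X)) * L μ := by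
            gcongr
            rw [← lintegral_const_mul _ hf.measurable]
            exact lintegral_mono hgle
        _ = (1 - c)⁻¹ * ((∫⁻ x, f x ∂(μ.1 : Measure X)) * L μ) := mul_assoc _ _ _
        _ ≤ (1 - c)⁻¹ * ENNReal.ofReal t⁻¹ := by
            gcongr
            exact mul_negExp_const_mul_le ht (hf.lintegral_ne_top μ.1)
  rw [mul_assoc]
  exact (ENNReal.add_left_inj hfin).1 h1

/-- A positive function on `[0, ∞)` is determined by its logarithmic derivative on `(0, ∞)` and its
limit at `0`. -/
lemma eq_of_hasDerivAt_mul {G H c : ℝ → ℝ} (hG : ∀ t, 0 < t → HasDerivAt G (c t * G t) t)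
    (hH : ∀ t, 0 < t → HasDerivAt H (c t * H t) t) (hH0 : ∀ t, 0 < t → H t ≠ 0)
    (hG1 : Filter.Tendsto (fun n : ℕ => G (1 / ((n : ℝ) + 1))) Filter.atTop (nhds 1))
    (hH1 : Filter.Tendsto (fun n : ℕ => H (1 / ((n : ℝ) + 1))) Filter.atTop (nhds 1)) :
    G 1 = H 1 := by
  -- Both functions have logarithmic derivative `c`, so their quotient is constant on `(0, ∞)`; the
  -- limit at `0` identifies the constant as `1`.
  have hd : ∀ t, 0 < t → HasDerivAt (fun t => G t / H t) 0 t := fun t ht => by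
    refine ((hG t ht).div (hH t ht) (hH0 t ht)).congr_deriv ?_
    rw [div_eq_zero_iff]
    left
    ring
  have hconst : ∀ t, 0 < t → G t / H t = G 1 / H 1 := fun t ht =>
    isOpen_Ioi.is_const_of_deriv_eq_zero isPreconnected_Ioi
      (fun s hs => (hd s hs).differentiableAt.differentiableWithinAt)
      (fun s hs => (hd s hs).deriv) (Set.mem_Ioi.2 ht) (Set.mem_Ioi.2 one_pos)
  have hlim := hG1.div hH1 one_ne_zero
  have hlim' : Filter.Tendsto (fun n : ℕ => G (1 / ((n : ℝ) + 1)) / H (1 / ((n : ℝ) + 1)))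
      Filter.atTop (nhds (G 1 / H 1)) :=
    tendsto_const_nhds.congr fun n => (hconst _ (by positivity)).symm
  have h1 := tendsto_nhds_unique hlim hlim'
  rw [div_one] at h1
  exact (div_eq_one_iff_eq (hH0 1 one_pos)).1 h1.symm

variable {Ω : Type*} [MeasurableSpace Ω] {P : Measure Ω} [IsProbabilityMeasure P] {Y : Ω → ℝ}

lemma integrable_exp_neg_mul (hY : Measurable Y) (hY0 : ∀ ω, 0 ≤ Y ω) {t : ℝ} (ht : 0 ≤ t) :
    Integrable (fun ω => Real.exp (-t * Y ω)) P := by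
  refine Integrable.of_bound (by fun_prop) 1 (ae_of_all _ fun ω => ?_)
  rw [Real.norm_of_nonneg (Real.exp_nonneg _)]
  exact Real.exp_le_one_iff.2 (by nlinarith [hY0 ω])

/-- Since `Y ≥ 0`, the moment generating function is finite on the negative half-line, so `-t` is an
interior point of its domain. At `t = 0` this may fail, which is why the limit there is treated
separately. -/
lemma hasDerivAt_integral_exp_neg_mul (hY : Measurable Y) (hY0 : ∀ ω, 0 ≤ Y ω) {t : ℝ}
    (ht : 0 < t) : HasDerivAt (fun t => ∫ ω, Real.exp (-t * Y ω) ∂P)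
      (-∫ ω, Y ω * Real.exp (-t * Y ω) ∂P) t := by
  have hint : -t ∈ interior (integrableExpSet Y P) := by
    refine mem_interior.2 ⟨Set.Iio 0, fun s hs => ?_, isOpen_Iio, Set.mem_Iio.2 (by linarith)⟩
    have := integrable_exp_neg_mul (P := P) hY hY0 (t := -s) (by linarith [Set.mem_Iio.1 hs])
    rw [neg_neg] at this
    exact this
  have h := (hasDerivAt_mgf hint).comp t (hasDerivAt_neg t)
  refine h.congr_deriv ?_
  ring

lemma tendsto_integral_exp_neg_mul (hY : Measurable Y) (hY0 : ∀ ω, 0 ≤ Y ω) :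
    Filter.Tendsto (fun n : ℕ => ∫ ω, Real.exp (-(1 / ((n : ℝ) + 1)) * Y ω) ∂P) Filter.atTop
      (nhds 1) := by
  have h : (1 : ℝ) = ∫ _, Real.exp (-0 * (0 : ℝ)) ∂P := by simp
  rw [h]
  refine tendsto_integral_of_dominated_convergence (fun _ => 1) (fun n => by fun_prop)
    (integrable_const _) (fun n => ae_of_all _ fun ω => ?_) (ae_of_all _ fun ω => ?_)
  · rw [Real.norm_of_nonneg (Real.exp_nonneg _)]
    refine Real.exp_le_one_iff.2 (mul_nonpos_of_nonpos_of_nonneg ?_ (hY0 ω))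
    exact neg_nonpos.2 (by positivity)
  · have := (((tendsto_one_div_add_atTop_nhds_zero_nat (𝕜 := ℝ)).neg.mul_const (Y ω)).rexp)
    simpa using this

/-- A Pólya sum process is unique. -/
theorem IsPolyaSumProcess.unique [SecondCountableTopology X] {z : ℝ} (hz : z ∈ Set.Ioo (0 : ℝ) 1) {ρ : LocFin X}
    {P Q : Measure (PointMeas X)} (hP : IsPolyaSumProcess z ρ P) (hQ : IsPolyaSumProcess z ρ Q) :
    P = Q := by
  have := hP.isProbabilityMeasure
  have := hQ.isProbabilityMeasure
  refine ext_of_laplace (j := fun μ : PointMeas X => μ.1) measurable_subtype_coe le_rfl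
    fun f hf => ?_
  let Y : PointMeas X → ℝ := fun μ => (∫⁻ x, f x ∂(μ.1 : Measure X)).toReal
  have hYm : Measurable Y :=
    ((measurable_lintegral_locFin hf.measurable).comp measurable_subtype_coe).ennreal_toReal
  have hY0 : ∀ μ, 0 ≤ Y μ := fun μ => ENNReal.toReal_nonneg
  have hY : ∀ μ : PointMeas X, ∫⁻ x, f x ∂(μ.1 : Measure X) = ENNReal.ofReal (Y μ) := fun μ =>
    (ENNReal.ofReal_toReal (hf.lintegral_ne_top μ.1)).symm
  have hexp : ∀ (t : ℝ), 0 ≤ t → ∀ μ, negExp (ENNReal.ofReal t * ENNReal.ofReal (Y μ)) =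
      ENNReal.ofReal (Real.exp (-t * Y μ)) := fun t ht μ => by
    rw [← ENNReal.ofReal_mul ht, negExp_ofReal (mul_nonneg ht (hY0 μ)), neg_mul]
  have hG : ∀ (P' : Measure (PointMeas X)) [IsProbabilityMeasure P'] (t : ℝ), 0 ≤ t →
      ∫⁻ μ, negExp (ENNReal.ofReal t * ENNReal.ofReal (Y μ)) ∂P' =
        ENNReal.ofReal (∫ μ, Real.exp (-t * Y μ) ∂P') := fun P' _ t ht => by
    rw [ofReal_integral_eq_lintegral_ofReal (integrable_exp_neg_mul hYm hY0 ht)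
      (ae_of_all _ fun μ => Real.exp_nonneg _)]
    exact lintegral_congr (hexp t ht)
  let c : ℝ → ℝ≥0∞ := fun t => ENNReal.ofReal z *
    ∫⁻ x, f x / (1 - ENNReal.ofReal z * negExp (ENNReal.ofReal t * f x)) *
      negExp (ENNReal.ofReal t * f x) ∂(ρ : Measure X)
  -- The coefficient `c` does not involve `P'`, so all Pólya sum processes with these parameters
  -- share one equation.
  have hderiv : ∀ P' : Measure (PointMeas X), IsPolyaSumProcess z ρ P' → ∀ t, 0 < t →
      HasDerivAt (fun t => ∫ μ, Real.exp (-t * Y μ) ∂P')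
        (-(c t).toReal * ∫ μ, Real.exp (-t * Y μ) ∂P') t := fun P' hP' t ht => by
    have := hP'.isProbabilityMeasure
    have h := hP'.lintegral_mul_negExp hz hf ht
    simp only [hY] at h
    rw [hG P' t ht.le] at h
    refine (hasDerivAt_integral_exp_neg_mul hYm hY0 ht).congr_deriv ?_
    rw [neg_mul, neg_inj, integral_eq_lintegral_of_nonneg_ae
      (ae_of_all _ fun μ => mul_nonneg (hY0 μ) (Real.exp_nonneg _))
      (by fun_prop : Measurable fun μ => Y μ * Real.exp (-t * Y μ)).aestronglyMeasurable]
    simp only [ENNReal.ofReal_mul (hY0 _), ← hexp t ht.le]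
    rw [h, ENNReal.toReal_mul,
      ENNReal.toReal_ofReal (integral_nonneg fun μ => Real.exp_nonneg _)]
  have hne : ∀ t, 0 < t → ∫ μ, Real.exp (-t * Y μ) ∂Q ≠ 0 := fun t ht =>
    (integral_exp_pos (integrable_exp_neg_mul hYm hY0 ht.le)).ne'
  have key := eq_of_hasDerivAt_mul (c := fun t => -(c t).toReal)
    (G := fun t => ∫ μ, Real.exp (-t * Y μ) ∂P) (H := fun t => ∫ μ, Real.exp (-t * Y μ) ∂Q) (hderiv P hP) (hderiv Q hQ) hne
    (tendsto_integral_exp_neg_mul hYm hY0) (tendsto_integral_exp_neg_mul hYm hY0)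
  have h1 := hG P 1 zero_le_one
  rw [key, ← hG Q 1 zero_le_one] at h1
  simpa only [hY, ENNReal.ofReal_one, one_mul] using h1

end Uniqueness

end CoxBayes

end

open CoxBayes
theorem theorem1 {X : Type*} [MetricSpace X] [CompleteSpace X] [SecondCountableTopology X]
    [MeasurableSpace X] [BorelSpace X] (z : ℝ) (hz : z ∈ Set.Ioo (0 : ℝ) 1) (ρ : LocFin X) :
    -- the Poisson processes form a measurable family of probability measures
    (∀ κ : LocFin X, IsProbabilityMeasure (poissonProcess κ)) ∧
    Measurable (poissonProcess : LocFin X → Measure (PointMeas X)) ∧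
    -- the prior is a probability measure on the locally finite measures
    IsProbabilityMeasure (poissonGamma z ρ) ∧
    -- the mixture is the (unique) Pólya sum process
    (∀ P : Measure (PointMeas X),
      IsPolyaSumProcess z ρ P ↔ P = coxProcess (poissonGamma z ρ)) ∧
    -- the posterior is Poisson-Gamma, and it is unique up to null sets
    (∃ B : Kernel (PointMeas X) (LocFin X),
      IsBayesKernel (poissonGamma z ρ) (coxProcess (poissonGamma z ρ)) B ∧
      ∀ μ : PointMeas X, B μ = poissonGamma (z / (1 + z)) (ρ + μ.1)) ∧
    (∀ B : Kernel (PointMeas X) (LocFin X),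
      IsBayesKernel (poissonGamma z ρ) (coxProcess (poissonGamma z ρ)) B →
      ∀ᵐ μ ∂(coxProcess (poissonGamma z ρ)),
        B μ = poissonGamma (z / (1 + z)) (ρ + μ.1)) := by
  have hPG := isProbabilityMeasure_poissonGamma hz ρ
  refine ⟨inferInstance, measurable_poissonProcess, hPG, fun P => ⟨fun hP => ?_, ?_⟩,
    ⟨posteriorKernel hz ρ, isBayesKernel_posteriorKernel hz ρ, fun _ => rfl⟩, fun B hB => ?_⟩
  · exact hP.unique hz (isPolyaSumProcess_coxProcess hz ρ)
  · rintro rfl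
    exact isPolyaSumProcess_coxProcess hz ρ
  · filter_upwards [hB.ae_eq (isBayesKernel_posteriorKernel hz ρ)] with μ hμ
    rw [hμ, posteriorKernel_apply]
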